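/- Let $\mathbb K$ be a field of characteristic zero; rings and algebras are associative and unital. **Rings with involution.** An *$R$-ring with involution* is a ring $A$ with a ring homomorphism $\rho_A:R\to A$ and an additive map $*:A\to A$ with $(ab)^*=b^*a^*$, $a^{**}=a$ and $\rho_A(r)^*=\rho_A(r)$; a *map* of $R$-rings with involution is a ring homomorphism $k$ with $k\circ\rho_A=\rho_B$ and $k(a^*)=k(a)^*$. **TGW algebras.** Let $R$ be a $\mathbb K$-algebra, $I$ a set, $\sigma=(\sigma_i)_{i\in I}$ commuting $\mathbb K$-algebra automorphisms of $R$, $t=(t_i)_{i\in I}$ nonzero central elements of $R$, and $\mu=(\mu_{ij})_{i\ne j}$ with $\mu_{ij}\in\mathbb K\setminus\{0\}$. Let $\mathcal C=\mathcal C_\mu(R,\sigma,t)$ be the $R$-ring generated by $X_i,Y_i$ $(i\in I)$ with relations $X_ir=\sigma_i(r)X_i$, $Y_ir=\sigma_i^{-1}(r)Y_i$, $Y_iX_i=t_i$, $X_iY_i=\sigma_i(t_i)$, and $X_iY_j=\mu_{ij}Y_jX_i$ for $i\neq j$. It is graded by the free abelian group $\mathbb ZI$ with $\deg X_i=i$,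 $\deg Y_i=-i$, $\deg r=0$. The TGW algebra $\mathcal A_\mu(R,\sigma,t)$ is the quotient of $\mathcal C$ by the sum of all graded two-sided ideals $J$ with $J\cap\mathcal C_0=0$, with the induced grading. It is *consistent* if the canonical map $\rho:R\to\mathcal A_\mu(R,\sigma,t)$ is injective. If $R$ is commutative and $\mu_{ij}=\mu_{ji}$ for all $i\ne j$, it is an $R$-ring with involution via $X_i^*=Y_i$, $Y_i^*=X_i$, $r^*=r$. **Weyl algebra.** For a set $E$ let $R_E=\mathbb K[u_e\mid e\in E]$, and let $A_E(\mathbb K)$ be the $\mathbb K$-algebra generated by $x_e,y_e$ $(e\in E)$ with relations $[x_e,x_f]=[y_e,y_f]=0$, $[y_e,x_f]=\delta_{ef}$. It is an $R_E$-ring with involution via $u_e\mapsto y_ex_e$ and $x_e^*=y_e$, $y_e^*=x_e$. For $k\in\mathbb ZE$ put $z^k=\prod_{e}z_e^{(k_e)}$, where $z_e^{(p)}=x_e^p$ if $p\ge0$ and $z_e^{(p)}=y_e^{-p}$ if $p<0$. **Multiquivers.** A multiquiver $\Gamma=(V,E,s,t)$ consists of sets $V,E$ and functions $s,t:E\to(V\times\mathbb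 Z_{>0})\cup\{\emptyset\}$ such that $s(e)=(u,m)$, $t(e)=(v,n)$ imply $u\ne v$, and for each $v\in V$ the sets $s^{-1}(\{v\}\times\mathbb Z_{>0})$ and $t^{-1}(\{v\}\times\mathbb Z_{>0})$ are finite. Put $\gamma_{ev}=n$ if $t(e)=(v,n)$, $\gamma_{ev}=-n$ if $s(e)=(v,n)$, and $\gamma_{ev}=0$ otherwise, and let $\gamma(v)=\sum_e\gamma_{ev}e\in\mathbb ZE$. Let $\mathcal A(\Gamma)$ be the TGW algebra $\mathcal A_\mu(R_E,\sigma,t)$ with index set $V$, all $\mu_{ij}=1$, $\sigma_v(u_e)=u_e-\gamma_{ev}$ and $t_v=\prod_{e:\gamma_{ev}\neq 0}u_{ev}$, where $u_{ev}=u_e(u_e+1)\cdots(u_e+\gamma_{ev}-1)$ if $\gamma_{ev}>0$ and $u_{ev}=(u_e-1)(u_e-2)\cdots(u_e-|\gamma_{ev}|)$ if $\gamma_{ev}<0$. Let $\varphi_\Gamma:\mathcal A(\Gamma)\to A_E(\mathbb K)$ be the unique map of $R_E$-rings with involution with $\varphi_\Gamma(X_v)=z^{\gamma(v)}$ and $\varphi_\Gamma(Y_v)=z^{-\gamma(v)}$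 for all $v\in V$. **Theorem.** Let $V$ and $E$ be sets, let $\mathcal A=\mathcal A_\mu(R_E,\sigma,t)$ be any TGW algebra with index set $V$ and base algebra $R_E$ such that $\mu_{ij}=\mu_{ji}$ for all $i\neq j$, and let $\varphi:\mathcal A\to A_E(\mathbb K)$ be a map of $R_E$-rings with involution. Then $\mathcal A$ is consistent, and there exist a multiquiver $\Gamma=(V,E,s,t)$ with vertex set $V$ and edge set $E$ and a map $\xi:\mathcal A\to\mathcal A(\Gamma)$ of $\mathbb ZV$-graded $R_E$-rings with involution such that $\varphi=\varphi_\Gamma\circ\xi$. Moreover, if $\varphi(X_i)\ne0$ for each $i\in V$, then the multiquiver $\Gamma$ with this property is unique, and $\mu_{ij}=1$ for all $i,j\in V$ with $i\neq j$. -/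

import Mathlib

namespace TGW

noncomputable section

/-! ### Rings with involution over a base ring -/

/-- The structure of an `R`-ring with involution on a ring `A`: a ring homomorphism `ρ : R → A`
and an additive, anti-multiplicative, involutive map `inv : A → A` fixing the image of `ρ`. -/
structure RingInvolution (R A : Type*) [Ring R] [Ring A] where
  ρ : R →+* A
  inv : A →+ A
  inv_mul : ∀ a b, inv (a * b) = inv b * inv a
  inv_inv : ∀ a, inv (inv a) = a
  inv_ρ : ∀ r, inv (ρ r) = ρ r

/-- A ring homomorphism `k : A → B` is a map of `R`-rings with involution. -/
def RingInvolution.IsMap {R A B : Type*} [Ring R] [Ring A] [Ring B]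
    (SA : RingInvolution R A) (SB : RingInvolution R B) (k : A →+* B) : Prop :=
  k.comp SA.ρ = SB.ρ ∧ ∀ a, k (SA.inv a) = SB.inv (k a)

/-! ### Twisted generalized Weyl data, constructions and algebras -/

/-- A twisted generalized Weyl datum `(R, σ, t)` over `K` with index set `I`. -/
structure Datum (K R I : Type*) [Field K] [Ring R] [Algebra K R] where
  σ : I → R ≃ₐ[K] R
  σ_comm : ∀ i j r, σ i (σ j r) = σ j (σ i r)
  t : I → R
  t_ne_zero : ∀ i, t i ≠ 0
  t_central : ∀ i r, t i * r = r * t i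

/-- Generators: the elements of the base algebra, and `X i`, `Y i` for `i : I`. -/
inductive Gen (R I : Type*)
  | base (r : R) : Gen R I
  | X (i : I) : Gen R I
  | Y (i : I) : Gen R I

section General

variable {K R I : Type*} [Field K] [Ring R] [Algebra K R]

/-- A generator, as an element of the free `K`-algebra on all generators. -/
abbrev fgen (K : Type*) {R I : Type*} [Field K] (g : Gen R I) : FreeAlgebra K (Gen R I) :=
  FreeAlgebra.ι K g

/-- The defining relations of the twisted generalized Weyl construction. The relations
`base_add`, `base_mul`, `base_scalar` say that `r ↦ base r` is a homomorphism of `K`-algebras, so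
that the quotient by them is the free `R`-ring on the `X i`, `Y i` in which `K` is central. (In the
quotient of the free `R`-ring by the remaining relations `K` is central automatically, since each
`σ i` is `K`-linear.) The entries `μ i i` are not used. -/
inductive Rel (D : Datum K R I) (μ : I → I → K) :
    FreeAlgebra K (Gen R I) → FreeAlgebra K (Gen R I) → Prop
  | base_add (r s : R) : Rel D μ (fgen K (.base (r + s))) (fgen K (.base r) + fgen K (.base s))
  | base_mul (r s : R) : Rel D μ (fgen K (.base (r * s))) (fgen K (.base r) * fgen K (.base s))
  | base_scalar (c : K) : Rel D μ (fgen K (.base (algebraMap K R c))) (algebraMap K _ c)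
  | X_base (i : I) (r : R) :
      Rel D μ (fgen K (.X i) * fgen K (.base r)) (fgen K (.base (D.σ i r)) * fgen K (.X i))
  | Y_base (i : I) (r : R) :
      Rel D μ (fgen K (.Y i) * fgen K (.base r)) (fgen K (.base ((D.σ i).symm r)) * fgen K (.Y i))
  | YX (i : I) : Rel D μ (fgen K (.Y i) * fgen K (.X i)) (fgen K (.base (D.t i)))
  | XY (i : I) : Rel D μ (fgen K (.X i) * fgen K (.Y i)) (fgen K (.base (D.σ i (D.t i))))
  | XY_ne (i j : I) (h : i ≠ j) :
      Rel D μ (fgen K (.X i) * fgen K (.Y j)) (μ i j • (fgen K (.Y j) * fgen K (.X i)))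

/-- The twisted generalized Weyl construction `C_μ(R, σ, t)`. -/
def Constr (D : Datum K R I) (μ : I → I → K) : Type _ := RingQuot (Rel D μ)

instance (D : Datum K R I) (μ : I → I → K) : Ring (Constr D μ) :=
  inferInstanceAs (Ring (RingQuot (Rel D μ)))

instance (D : Datum K R I) (μ : I → I → K) : Algebra K (Constr D μ) :=
  inferInstanceAs (Algebra K (RingQuot (Rel D μ)))

/-- The quotient map from the free algebra. -/
def Constr.mk (D : Datum K R I) (μ : I → I → K) : FreeAlgebra K (Gen R I) →ₐ[K] Constr D μ :=
  RingQuot.mkAlgHom K (Rel D μ)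

theorem Constr.mk_surjective (D : Datum K R I) (μ : I → I → K) :
    Function.Surjective (Constr.mk D μ) :=
  RingQuot.mkAlgHom_surjective K (Rel D μ)

theorem Constr.mk_rel {D : Datum K R I} {μ : I → I → K} {a b : FreeAlgebra K (Gen R I)}
    (h : Rel D μ a b) : Constr.mk D μ a = Constr.mk D μ b :=
  RingQuot.mkAlgHom_rel K h

/-- The image of a generator in `C_μ(R, σ, t)`. -/
def Constr.gen (D : Datum K R I) (μ : I → I → K) (g : Gen R I) : Constr D μ :=
  Constr.mk D μ (fgen K g)

/-- The degree of a generator in the free abelian group `ℤ I`. -/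
def Gen.deg {R I : Type*} : Gen R I → (I →₀ ℤ)
  | .base _ => 0
  | .X i => Finsupp.single i 1
  | .Y i => -Finsupp.single i 1

/-- The homogeneous component `C_d` of degree `d`: the `K`-span of all products of generators
whose degrees add up to `d`. -/
def Constr.comp (D : Datum K R I) (μ : I → I → K) (d : I →₀ ℤ) : Submodule K (Constr D μ) :=
  Submodule.span K {a | ∃ l : List (Gen R I),
    (l.map Gen.deg).sum = d ∧ a = (l.map (Constr.gen D μ)).prod}

/-- The left ideal `J` is a graded two-sided ideal with `J ∩ C_0 = 0`. (It is graded when every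
element of it is a sum of homogeneous elements of it.) -/
structure IsNullIdeal {D : Datum K R I} {μ : I → I → K} (J : Ideal (Constr D μ)) : Prop where
  twoSided : J.IsTwoSided
  graded : ∀ a ∈ J, a ∈ AddSubgroup.closure {b | b ∈ J ∧ ∃ d, b ∈ Constr.comp D μ d}
  zero_inter : ∀ a ∈ J, a ∈ Constr.comp D μ 0 → a = 0

/-- The sum of all graded two-sided ideals `J` of `C_μ(R, σ, t)` with `J ∩ C_0 = 0`. -/
def radical (D : Datum K R I) (μ : I → I → K) : Ideal (Constr D μ) :=
  sSup {J | IsNullIdeal J}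

instance radical_isTwoSided (D : Datum K R I) (μ : I → I → K) : (radical D μ).IsTwoSided where
  mul_mem_of_left {a} b ha := by
    unfold radical at ha ⊢
    rw [sSup_eq_iSup'] at ha
    induction ha using Submodule.iSup_induction' with
    | mem J x hx =>
      have := J.2.twoSided
      exact Submodule.mem_sSup_of_mem J.2 (J.1.mul_mem_right b hx)
    | zero => simp
    | add x y _ _ hx hy => rw [add_mul]; exact add_mem hx hy

/-- The twisted generalized Weyl algebra `A_μ(R, σ, t)`. -/
def Alg (D : Datum K R I) (μ : I → I → K) : Type _ := Constr D μ ⧸ radical D μ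

instance (D : Datum K R I) (μ : I → I → K) : Ring (Alg D μ) :=
  inferInstanceAs (Ring (Constr D μ ⧸ radical D μ))

instance (D : Datum K R I) (μ : I → I → K) : Algebra K (Alg D μ) :=
  inferInstanceAs (Algebra K (Constr D μ ⧸ radical D μ))

/-- The quotient map `C_μ(R, σ, t) → A_μ(R, σ, t)`. -/
def Alg.mk (D : Datum K R I) (μ : I → I → K) : Constr D μ →ₐ[K] Alg D μ :=
  Ideal.Quotient.mkₐ K (radical D μ)

/-- The generator `X i` of `A_μ(R, σ, t)`. -/
def Alg.X (D : Datum K R I) (μ : I → I → K) (i : I) : Alg D μ :=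
  Alg.mk D μ (Constr.gen D μ (.X i))

/-- The generator `Y i` of `A_μ(R, σ, t)`. -/
def Alg.Y (D : Datum K R I) (μ : I → I → K) (i : I) : Alg D μ :=
  Alg.mk D μ (Constr.gen D μ (.Y i))

/-- The homogeneous component of degree `d` of `A_μ(R, σ, t)`. -/
def Alg.comp (D : Datum K R I) (μ : I → I → K) (d : I →₀ ℤ) : Submodule K (Alg D μ) :=
  (Constr.comp D μ d).map (Alg.mk D μ).toLinearMap

/-- The canonical map `R → C_μ(R, σ, t)`. -/
def Constr.base (D : Datum K R I) (μ : I → I → K) : R →ₐ[K] Constr D μ :=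
  AlgHom.ofLinearMap
    { toFun := fun r => Constr.gen D μ (.base r)
      map_add' := fun r s => by
        simp only [Constr.gen, Constr.mk_rel (Rel.base_add (D := D) (μ := μ) r s), map_add]
      map_smul' := fun c r => by
        simp only [Constr.gen, Algebra.smul_def, RingHom.id_apply]
        rw [Constr.mk_rel (Rel.base_mul (D := D) (μ := μ) _ r), map_mul,
          Constr.mk_rel (Rel.base_scalar (D := D) (μ := μ) c), AlgHom.commutes] }
    (by
      have := Constr.mk_rel (Rel.base_scalar (D := D) (μ := μ) 1)
      simpa [Constr.gen] using this)
    (fun r s => by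
      simp only [Constr.gen, LinearMap.coe_mk, AddHom.coe_mk]
      rw [Constr.mk_rel (Rel.base_mul (D := D) (μ := μ) r s), map_mul])

/-- The canonical map `ρ : R → A_μ(R, σ, t)`. -/
def Alg.base (D : Datum K R I) (μ : I → I → K) : R →ₐ[K] Alg D μ :=
  (Alg.mk D μ).comp (Constr.base D μ)

/-- `A_μ(R, σ, t)` is consistent when the canonical map `ρ` is injective. -/
def IsConsistent (D : Datum K R I) (μ : I → I → K) : Prop :=
  Function.Injective (Alg.base D μ)

/-- A map between two twisted generalized Weyl algebras with the same index set is graded. -/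
def IsGradedMap {D D' : Datum K R I} {μ μ' : I → I → K} (f : Alg D μ →+* Alg D' μ') : Prop :=
  ∀ d, ∀ a ∈ Alg.comp D μ d, f a ∈ Alg.comp D' μ' d

end General

/-! ### The involution of a twisted generalized Weyl algebra with symmetric `μ` -/

section Involution

variable {K R I : Type*} [Field K] [CommRing R] [Algebra K R]

/-- The exchange of `X i` and `Y i`. -/
def Gen.swap {R I : Type*} : Gen R I → Gen R I
  | .base r => .base r
  | .X i => .Y i
  | .Y i => .X i

theorem Constr.gen_X_base (D : Datum K R I) (μ : I → I → K) (i : I) (r : R) :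
    Constr.gen D μ (.X i) * Constr.gen D μ (.base r) =
      Constr.gen D μ (.base (D.σ i r)) * Constr.gen D μ (.X i) := by
  simpa [Constr.gen] using Constr.mk_rel (Rel.X_base (D := D) (μ := μ) i r)

theorem Constr.gen_Y_base (D : Datum K R I) (μ : I → I → K) (i : I) (r : R) :
    Constr.gen D μ (.Y i) * Constr.gen D μ (.base r) =
      Constr.gen D μ (.base ((D.σ i).symm r)) * Constr.gen D μ (.Y i) := by
  simpa [Constr.gen] using Constr.mk_rel (Rel.Y_base (D := D) (μ := μ) i r)

theorem Constr.gen_YX (D : Datum K R I) (μ : I → I → K) (i : I) :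
    Constr.gen D μ (.Y i) * Constr.gen D μ (.X i) = Constr.gen D μ (.base (D.t i)) := by
  simpa [Constr.gen] using Constr.mk_rel (Rel.YX (D := D) (μ := μ) i)

theorem Constr.gen_XY (D : Datum K R I) (μ : I → I → K) (i : I) :
    Constr.gen D μ (.X i) * Constr.gen D μ (.Y i) = Constr.gen D μ (.base (D.σ i (D.t i))) := by
  simpa [Constr.gen] using Constr.mk_rel (Rel.XY (D := D) (μ := μ) i)

theorem Constr.gen_XY_ne (D : Datum K R I) (μ : I → I → K) (i j : I) (h : i ≠ j) :
    Constr.gen D μ (.X i) * Constr.gen D μ (.Y j) =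
      μ i j • (Constr.gen D μ (.Y j) * Constr.gen D μ (.X i)) := by
  simpa [Constr.gen] using Constr.mk_rel (Rel.XY_ne (D := D) (μ := μ) i j h)

theorem Constr.flip_rel (D : Datum K R I) (μ : I → I → K) (hμ : ∀ i j, i ≠ j → μ i j = μ j i)
    ⦃a b : FreeAlgebra K (Gen R I)⦄ (h : Rel D μ a b) :
    FreeAlgebra.lift K (fun g => MulOpposite.op (Constr.gen D μ g.swap)) a =
      FreeAlgebra.lift K (fun g => MulOpposite.op (Constr.gen D μ g.swap)) b := by
  induction h with
  | base_add r s =>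
    simp only [map_add, FreeAlgebra.lift_ι_apply, Gen.swap, ← MulOpposite.op_add]
    exact congrArg MulOpposite.op ((Constr.base D μ).map_add r s)
  | base_mul r s =>
    simp only [map_mul, FreeAlgebra.lift_ι_apply, Gen.swap, ← MulOpposite.op_mul]
    rw [mul_comm r s]
    exact congrArg MulOpposite.op ((Constr.base D μ).map_mul s r)
  | base_scalar c =>
    simp only [FreeAlgebra.lift_ι_apply, Gen.swap, AlgHom.commutes,
      MulOpposite.algebraMap_apply]
    exact congrArg MulOpposite.op ((Constr.base D μ).commutes c)
  | X_base i r =>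
    simp only [map_mul, FreeAlgebra.lift_ι_apply, Gen.swap, ← MulOpposite.op_mul]
    rw [Constr.gen_Y_base, AlgEquiv.symm_apply_apply]
  | Y_base i r =>
    simp only [map_mul, FreeAlgebra.lift_ι_apply, Gen.swap, ← MulOpposite.op_mul]
    rw [Constr.gen_X_base, AlgEquiv.apply_symm_apply]
  | YX i =>
    simp only [map_mul, FreeAlgebra.lift_ι_apply, Gen.swap, ← MulOpposite.op_mul]
    rw [Constr.gen_YX]
  | XY i =>
    simp only [map_mul, FreeAlgebra.lift_ι_apply, Gen.swap, ← MulOpposite.op_mul]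
    rw [Constr.gen_XY]
  | XY_ne i j h =>
    simp only [map_mul, map_smul, FreeAlgebra.lift_ι_apply, Gen.swap, ← MulOpposite.op_mul,
      ← MulOpposite.op_smul]
    rw [Constr.gen_XY_ne D μ j i h.symm, hμ i j h]

/-- The anti-automorphism of `C_μ(R, σ, t)` exchanging `X i` and `Y i` and fixing `R`, as a
homomorphism to the opposite algebra. -/
def Constr.flip (D : Datum K R I) (μ : I → I → K) (hμ : ∀ i j, i ≠ j → μ i j = μ j i) :
    Constr D μ →ₐ[K] (Constr D μ)ᵐᵒᵖ :=
  RingQuot.liftAlgHom K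
    ⟨FreeAlgebra.lift K fun g => MulOpposite.op (Constr.gen D μ g.swap), Constr.flip_rel D μ hμ⟩

variable (D : Datum K R I) (μ : I → I → K) (hμ : ∀ i j, i ≠ j → μ i j = μ j i)

theorem Constr.flip_gen (g : Gen R I) :
    Constr.flip D μ hμ (Constr.gen D μ g) = MulOpposite.op (Constr.gen D μ g.swap) := by
  have h := RingQuot.liftAlgHom_mkAlgHom_apply K
    (FreeAlgebra.lift K fun g => MulOpposite.op (Constr.gen D μ (Gen.swap g)))
    (s := Rel D μ) (Constr.flip_rel D μ hμ) (fgen K g)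
  rw [FreeAlgebra.lift_ι_apply] at h
  exact h

/-- The involution of `C_μ(R, σ, t)`, for symmetric `μ`. -/
def Constr.inv : Constr D μ →ₗ[K] Constr D μ :=
  (MulOpposite.opLinearEquiv K).symm.toLinearMap ∘ₗ (Constr.flip D μ hμ).toLinearMap

theorem Constr.inv_gen (g : Gen R I) :
    Constr.inv D μ hμ (Constr.gen D μ g) = Constr.gen D μ g.swap := by
  simp [Constr.inv, Constr.flip_gen]

theorem Constr.inv_mul (a b : Constr D μ) :
    Constr.inv D μ hμ (a * b) = Constr.inv D μ hμ b * Constr.inv D μ hμ a := by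
  simp [Constr.inv]

theorem Constr.inv_algebraMap (c : K) :
    Constr.inv D μ hμ (algebraMap K _ c) = algebraMap K _ c := by
  simp [Constr.inv, MulOpposite.algebraMap_apply]

theorem Constr.inv_inv (a : Constr D μ) : Constr.inv D μ hμ (Constr.inv D μ hμ a) = a := by
  obtain ⟨a, rfl⟩ := Constr.mk_surjective D μ a
  induction a using FreeAlgebra.induction with
  | grade0 c => simp [AlgHom.commutes, Constr.inv_algebraMap]
  | grade1 g =>
    change Constr.inv D μ hμ (Constr.inv D μ hμ (Constr.gen D μ g)) = Constr.gen D μ g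
    rw [Constr.inv_gen, Constr.inv_gen]
    cases g <;> rfl
  | mul a b ha hb => rw [map_mul, Constr.inv_mul, Constr.inv_mul, ha, hb]
  | add a b ha hb => rw [map_add, map_add, map_add, ha, hb]

theorem Constr.inv_mem_comp {d : I →₀ ℤ} {a : Constr D μ} (ha : a ∈ Constr.comp D μ d) :
    Constr.inv D μ hμ a ∈ Constr.comp D μ (-d) := by
  unfold Constr.comp at ha
  induction ha using Submodule.span_induction with
  | mem a ha =>
    obtain ⟨l, rfl, rfl⟩ := ha
    refine Submodule.subset_span ⟨(l.map Gen.swap).reverse, ?_, ?_⟩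
    · rw [List.map_reverse, List.sum_reverse]
      induction l with
      | nil => simp
      | cons g l ih =>
        simp only [List.map_cons, List.sum_cons, ih, neg_add_rev]
        cases g <;> simp [Gen.swap, Gen.deg, add_comm]
    · induction l with
      | nil =>
        have := Constr.inv_algebraMap D μ hμ 1
        simpa using this
      | cons g l ih =>
        rw [List.map_cons, List.prod_cons, Constr.inv_mul, ih, Constr.inv_gen]
        simp
  | zero => simp
  | add a b _ _ ha hb => rw [map_add]; exact add_mem ha hb
  | smul c a _ ha => rw [map_smul]; exact Submodule.smul_mem _ c ha

/-- The image of a two-sided ideal under the involution. -/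
def invIdeal (J : Ideal (Constr D μ)) (hJ : J.IsTwoSided) : Ideal (Constr D μ) where
  carrier := {a | Constr.inv D μ hμ a ∈ J}
  add_mem' {a b} ha hb := by
    simp only [Set.mem_ofPred_eq, map_add] at ha hb ⊢
    exact add_mem ha hb
  zero_mem' := by simp
  smul_mem' c a ha := by
    simp only [Set.mem_ofPred_eq, smul_eq_mul, Constr.inv_mul] at ha ⊢
    exact J.mul_mem_right _ ha

theorem invIdeal_isNullIdeal (J : Ideal (Constr D μ)) (hJ : IsNullIdeal J) :
    IsNullIdeal (invIdeal D μ hμ J hJ.twoSided) where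
  twoSided := ⟨fun {a} b ha => by
    change Constr.inv D μ hμ (a * b) ∈ J
    rw [Constr.inv_mul]
    exact J.mul_mem_left _ ha⟩
  graded := by
    intro a ha
    have key : ∀ c ∈ AddSubgroup.closure {b | b ∈ J ∧ ∃ d, b ∈ Constr.comp D μ d},
        Constr.inv D μ hμ c ∈ AddSubgroup.closure
          {b | b ∈ invIdeal D μ hμ J hJ.twoSided ∧ ∃ d, b ∈ Constr.comp D μ d} := by
      intro c hc
      induction hc using AddSubgroup.closure_induction with
      | mem c hc =>
        obtain ⟨hc, d, hd⟩ := hc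
        refine AddSubgroup.subset_closure ⟨?_, -d, Constr.inv_mem_comp D μ hμ hd⟩
        change Constr.inv D μ hμ (Constr.inv D μ hμ c) ∈ J
        rwa [Constr.inv_inv]
      | zero => simp
      | add x y _ _ hx hy => rw [map_add]; exact add_mem hx hy
      | neg x _ hx => rw [map_neg]; exact neg_mem hx
    have := key _ (hJ.graded _ ha)
    rwa [Constr.inv_inv] at this
  zero_inter := by
    intro a ha h0
    have h1 := Constr.inv_mem_comp D μ hμ h0
    rw [neg_zero] at h1
    have := hJ.zero_inter _ ha h1
    rw [← Constr.inv_inv D μ hμ a, this, map_zero]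

theorem inv_mem_radical {a : Constr D μ} (ha : a ∈ radical D μ) :
    Constr.inv D μ hμ a ∈ radical D μ := by
  have hle : radical D μ ≤ invIdeal D μ hμ (radical D μ) (radical_isTwoSided D μ) := by
    refine sSup_le fun J hJ x hx => ?_
    refine Submodule.mem_sSup_of_mem (invIdeal_isNullIdeal D μ hμ J hJ) ?_
    change Constr.inv D μ hμ (Constr.inv D μ hμ x) ∈ J
    rwa [Constr.inv_inv]
  exact hle ha

/-- The involution of `A_μ(R, σ, t)`, for symmetric `μ`: it is the map induced by the involution
of `C_μ(R, σ, t)`, which exchanges `X i` and `Y i` and fixes `R`. -/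
def Alg.inv : Alg D μ →+ Alg D μ :=
  QuotientAddGroup.map (radical D μ).toAddSubgroup (radical D μ).toAddSubgroup
    (Constr.inv D μ hμ).toAddMonoidHom (fun _ ha => inv_mem_radical D μ hμ ha)

theorem Alg.mk_surjective : Function.Surjective (Alg.mk D μ) := Ideal.Quotient.mk_surjective

theorem Alg.inv_mk (a : Constr D μ) :
    Alg.inv D μ hμ (Alg.mk D μ a) = Alg.mk D μ (Constr.inv D μ hμ a) := rfl

theorem Alg.inv_X (i : I) : Alg.inv D μ hμ (Alg.X D μ i) = Alg.Y D μ i := by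
  rw [Alg.X, Alg.inv_mk, Constr.inv_gen]; rfl

theorem Alg.inv_Y (i : I) : Alg.inv D μ hμ (Alg.Y D μ i) = Alg.X D μ i := by
  rw [Alg.Y, Alg.inv_mk, Constr.inv_gen]; rfl

/-- `A_μ(R, σ, t)` as an `R`-ring with involution, for symmetric `μ`. -/
def Alg.ringInvolution : RingInvolution R (Alg D μ) where
  ρ := (Alg.base D μ).toRingHom
  inv := Alg.inv D μ hμ
  inv_mul a b := by
    obtain ⟨a, rfl⟩ := Alg.mk_surjective D μ a
    obtain ⟨b, rfl⟩ := Alg.mk_surjective D μ b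
    rw [← map_mul, Alg.inv_mk, Alg.inv_mk, Alg.inv_mk, Constr.inv_mul, map_mul]
  inv_inv a := by
    obtain ⟨a, rfl⟩ := Alg.mk_surjective D μ a
    rw [Alg.inv_mk, Alg.inv_mk, Constr.inv_inv]
  inv_ρ r := by
    change Alg.inv D μ hμ (Alg.mk D μ (Constr.gen D μ (.base r))) =
      Alg.mk D μ (Constr.gen D μ (.base r))
    rw [Alg.inv_mk, Constr.inv_gen]; rfl

end Involution

/-! ### The Weyl algebra -/

/-- Generators `x e`, `y e` of the Weyl algebra. -/
inductive WeylGen (E : Type*)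
  | x (e : E) : WeylGen E
  | y (e : E) : WeylGen E

section Weyl

/-- The defining relations of the Weyl algebra:
`[x_e, x_f] = [y_e, y_f] = 0` and `[y_e, x_f] = δ_{ef}`. -/
inductive WeylRel (K E : Type*) [Field K] :
    FreeAlgebra K (WeylGen E) → FreeAlgebra K (WeylGen E) → Prop
  | xx (e f : E) : WeylRel K E (FreeAlgebra.ι K (.x e) * FreeAlgebra.ι K (.x f))
      (FreeAlgebra.ι K (.x f) * FreeAlgebra.ι K (.x e))
  | yy (e f : E) : WeylRel K E (FreeAlgebra.ι K (.y e) * FreeAlgebra.ι K (.y f))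
      (FreeAlgebra.ι K (.y f) * FreeAlgebra.ι K (.y e))
  | yx (e : E) : WeylRel K E (FreeAlgebra.ι K (.y e) * FreeAlgebra.ι K (.x e))
      (FreeAlgebra.ι K (.x e) * FreeAlgebra.ι K (.y e) + 1)
  | yx_ne (e f : E) (h : e ≠ f) : WeylRel K E (FreeAlgebra.ι K (.y e) * FreeAlgebra.ι K (.x f))
      (FreeAlgebra.ι K (.x f) * FreeAlgebra.ι K (.y e))

/-- The Weyl algebra `A_E(K)` over `K` with index set `E`. -/
def Weyl (K E : Type*) [Field K] : Type _ := RingQuot (WeylRel K E)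

variable {K E : Type*} [Field K]

instance : Ring (Weyl K E) := inferInstanceAs (Ring (RingQuot (WeylRel K E)))

instance : Algebra K (Weyl K E) := inferInstanceAs (Algebra K (RingQuot (WeylRel K E)))

/-- The quotient map from the free algebra. -/
def Weyl.mk (K E : Type*) [Field K] : FreeAlgebra K (WeylGen E) →ₐ[K] Weyl K E :=
  RingQuot.mkAlgHom K (WeylRel K E)

theorem Weyl.mk_surjective : Function.Surjective (Weyl.mk K E) :=
  RingQuot.mkAlgHom_surjective K (WeylRel K E)

theorem Weyl.mk_rel {a b : FreeAlgebra K (WeylGen E)} (h : WeylRel K E a b) :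
    Weyl.mk K E a = Weyl.mk K E b :=
  RingQuot.mkAlgHom_rel K h

/-- The generator `x e` of the Weyl algebra. -/
def Weyl.x (K : Type*) {E : Type*} [Field K] (e : E) : Weyl K E :=
  Weyl.mk K E (FreeAlgebra.ι K (.x e))

/-- The generator `y e` of the Weyl algebra. -/
def Weyl.y (K : Type*) {E : Type*} [Field K] (e : E) : Weyl K E :=
  Weyl.mk K E (FreeAlgebra.ι K (.y e))

theorem Weyl.x_mul_x (e f : E) : Weyl.x K e * Weyl.x K f = Weyl.x K f * Weyl.x K e := by
  simpa [Weyl.x] using Weyl.mk_rel (WeylRel.xx (K := K) e f)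

theorem Weyl.y_mul_y (e f : E) : Weyl.y K e * Weyl.y K f = Weyl.y K f * Weyl.y K e := by
  simpa [Weyl.y] using Weyl.mk_rel (WeylRel.yy (K := K) e f)

theorem Weyl.y_mul_x (e : E) : Weyl.y K e * Weyl.x K e = Weyl.x K e * Weyl.y K e + 1 := by
  simpa [Weyl.x, Weyl.y] using Weyl.mk_rel (WeylRel.yx (K := K) e)

theorem Weyl.y_mul_x_ne {e f : E} (h : e ≠ f) :
    Weyl.y K e * Weyl.x K f = Weyl.x K f * Weyl.y K e := by
  simpa [Weyl.x, Weyl.y] using Weyl.mk_rel (WeylRel.yx_ne (K := K) e f h)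

/-- The exchange of `x e` and `y e`. -/
def Weyl.swapGen (K : Type*) {E : Type*} [Field K] : WeylGen E → Weyl K E
  | .x e => Weyl.y K e
  | .y e => Weyl.x K e

theorem Weyl.flip_rel ⦃a b : FreeAlgebra K (WeylGen E)⦄ (h : WeylRel K E a b) :
    FreeAlgebra.lift K (fun g => MulOpposite.op (Weyl.swapGen K g)) a =
      FreeAlgebra.lift K (fun g => MulOpposite.op (Weyl.swapGen K g)) b := by
  induction h with
  | xx e f =>
    simp only [map_mul, FreeAlgebra.lift_ι_apply, Weyl.swapGen, ← MulOpposite.op_mul]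
    rw [Weyl.y_mul_y]
  | yy e f =>
    simp only [map_mul, FreeAlgebra.lift_ι_apply, Weyl.swapGen, ← MulOpposite.op_mul]
    rw [Weyl.x_mul_x]
  | yx e =>
    simp only [map_mul, map_add, map_one, FreeAlgebra.lift_ι_apply, Weyl.swapGen, ← MulOpposite.op_mul]
    rw [Weyl.y_mul_x]; rfl
  | yx_ne e f h =>
    simp only [map_mul, FreeAlgebra.lift_ι_apply, Weyl.swapGen, ← MulOpposite.op_mul]
    rw [Weyl.y_mul_x_ne h.symm]

/-- The anti-automorphism of the Weyl algebra exchanging `x e` and `y e`, as a homomorphism to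
the opposite algebra. -/
def Weyl.flip (K E : Type*) [Field K] : Weyl K E →ₐ[K] (Weyl K E)ᵐᵒᵖ :=
  RingQuot.liftAlgHom K
    ⟨FreeAlgebra.lift K fun g => MulOpposite.op (Weyl.swapGen K g), Weyl.flip_rel⟩

theorem Weyl.flip_x (e : E) : Weyl.flip K E (Weyl.x K e) = MulOpposite.op (Weyl.y K e) := by
  refine (RingQuot.liftAlgHom_mkAlgHom_apply K _ (s := WeylRel K E) Weyl.flip_rel
    (FreeAlgebra.ι K (.x e))).trans ?_
  rw [FreeAlgebra.lift_ι_apply]; rfl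

theorem Weyl.flip_y (e : E) : Weyl.flip K E (Weyl.y K e) = MulOpposite.op (Weyl.x K e) := by
  refine (RingQuot.liftAlgHom_mkAlgHom_apply K _ (s := WeylRel K E) Weyl.flip_rel
    (FreeAlgebra.ι K (.y e))).trans ?_
  rw [FreeAlgebra.lift_ι_apply]; rfl

/-- The involution of the Weyl algebra. -/
def Weyl.inv (K E : Type*) [Field K] : Weyl K E →ₗ[K] Weyl K E :=
  (MulOpposite.opLinearEquiv K).symm.toLinearMap ∘ₗ (Weyl.flip K E).toLinearMap

theorem Weyl.inv_x (e : E) : Weyl.inv K E (Weyl.x K e) = Weyl.y K e := by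
  simp [Weyl.inv, Weyl.flip_x]

theorem Weyl.inv_y (e : E) : Weyl.inv K E (Weyl.y K e) = Weyl.x K e := by
  simp [Weyl.inv, Weyl.flip_y]

theorem Weyl.inv_mul (a b : Weyl K E) :
    Weyl.inv K E (a * b) = Weyl.inv K E b * Weyl.inv K E a := by
  simp [Weyl.inv]

theorem Weyl.inv_algebraMap (c : K) :
    Weyl.inv K E (algebraMap K _ c) = algebraMap K _ c := by
  simp [Weyl.inv, MulOpposite.algebraMap_apply]

theorem Weyl.inv_inv (a : Weyl K E) : Weyl.inv K E (Weyl.inv K E a) = a := by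
  obtain ⟨a, rfl⟩ := Weyl.mk_surjective a
  induction a using FreeAlgebra.induction with
  | grade0 c => simp [AlgHom.commutes, Weyl.inv_algebraMap]
  | grade1 g =>
    cases g with
    | x e =>
      change Weyl.inv K E (Weyl.inv K E (Weyl.x K e)) = Weyl.x K e
      rw [Weyl.inv_x, Weyl.inv_y]
    | y e =>
      change Weyl.inv K E (Weyl.inv K E (Weyl.y K e)) = Weyl.y K e
      rw [Weyl.inv_y, Weyl.inv_x]
  | mul a b ha hb => rw [map_mul, Weyl.inv_mul, Weyl.inv_mul, ha, hb]
  | add a b ha hb => rw [map_add, map_add, map_add, ha, hb]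

theorem Weyl.yx_comm (e f : E) :
    (Weyl.y K e * Weyl.x K e) * (Weyl.y K f * Weyl.x K f) =
      (Weyl.y K f * Weyl.x K f) * (Weyl.y K e * Weyl.x K e) := by
  by_cases h : e = f
  · rw [h]
  · have h1 : Commute (Weyl.y K e) (Weyl.y K f) := Weyl.y_mul_y e f
    have h2 : Commute (Weyl.x K e) (Weyl.x K f) := Weyl.x_mul_x e f
    have h3 : Commute (Weyl.y K e) (Weyl.x K f) := Weyl.y_mul_x_ne h
    have h4 : Commute (Weyl.x K e) (Weyl.y K f) := (Weyl.y_mul_x_ne (Ne.symm h)).symm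
    exact ((h1.mul_right h3).mul_left (h4.mul_right h2))

/-- The subalgebra generated by the commuting elements `y e * x e`. -/
abbrev Weyl.torus (K E : Type*) [Field K] : Subalgebra K (Weyl K E) :=
  Algebra.adjoin K (Set.range fun e : E => Weyl.y K e * Weyl.x K e)

instance Weyl.isMulCommutative_torus (K E : Type*) [Field K] :
    IsMulCommutative (Weyl.torus K E) :=
  Algebra.isMulCommutative_adjoin K (by
    rintro _ ⟨e, rfl⟩ _ ⟨f, rfl⟩
    exact Weyl.yx_comm e f)

open scoped IsMulCommutative in
/-- The homomorphism `R_E = K[u_e | e ∈ E] → A_E(K)` with `u_e ↦ y_e x_e`. -/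
def Weyl.base (K E : Type*) [Field K] : MvPolynomial E K →ₐ[K] Weyl K E :=
  (Weyl.torus K E).val.comp
    (MvPolynomial.aeval fun e : E =>
      (⟨Weyl.y K e * Weyl.x K e, Algebra.subset_adjoin ⟨e, rfl⟩⟩ : Weyl.torus K E))

open scoped IsMulCommutative in
theorem Weyl.base_X (e : E) :
    Weyl.base K E (MvPolynomial.X e) = Weyl.y K e * Weyl.x K e := by
  simp [Weyl.base]

theorem Weyl.inv_base (r : MvPolynomial E K) :
    Weyl.inv K E (Weyl.base K E r) = Weyl.base K E r := by
  induction r using MvPolynomial.induction_on with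
  | C c =>
    have : Weyl.base K E (MvPolynomial.C c) = algebraMap K _ c := (Weyl.base K E).commutes c
    rw [this, Weyl.inv_algebraMap]
  | add p q hp hq => rw [map_add, map_add, hp, hq]
  | mul_X p e hp =>
    rw [mul_comm, map_mul, Weyl.inv_mul, hp, Weyl.base_X, Weyl.inv_mul, Weyl.inv_x, Weyl.inv_y,
      ← Weyl.base_X, ← map_mul, ← map_mul, mul_comm]

/-- The Weyl algebra `A_E(K)` as an `R_E`-ring with involution. -/
def Weyl.ringInvolution (K E : Type*) [Field K] :
    RingInvolution (MvPolynomial E K) (Weyl K E) where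
  ρ := (Weyl.base K E).toRingHom
  inv := (Weyl.inv K E).toAddMonoidHom
  inv_mul := Weyl.inv_mul
  inv_inv := Weyl.inv_inv
  inv_ρ := Weyl.inv_base

/-- `z_e^{(p)}`, which is `x_e ^ p` for `p ≥ 0` and `y_e ^ (-p)` for `p < 0`. -/
def Weyl.zpart (K : Type*) {E : Type*} [Field K] (e : E) (p : ℤ) : Weyl K E :=
  if 0 ≤ p then Weyl.x K e ^ p.toNat else Weyl.y K e ^ (-p).toNat

theorem Weyl.zpart_commute {e f : E} (h : e ≠ f) (p q : ℤ) :
    Commute (Weyl.zpart K e p) (Weyl.zpart K f q) := by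
  have h1 : Commute (Weyl.y K e) (Weyl.y K f) := Weyl.y_mul_y e f
  have h2 : Commute (Weyl.x K e) (Weyl.x K f) := Weyl.x_mul_x e f
  have h3 : Commute (Weyl.y K e) (Weyl.x K f) := Weyl.y_mul_x_ne h
  have h4 : Commute (Weyl.x K e) (Weyl.y K f) := (Weyl.y_mul_x_ne (Ne.symm h)).symm
  unfold Weyl.zpart
  split_ifs
  · exact h2.pow_pow _ _
  · exact h4.pow_pow _ _
  · exact h3.pow_pow _ _
  · exact h1.pow_pow _ _

/-- `z^k = ∏_e z_e^{(k_e)}` for `k` in the free abelian group `ℤ E`. -/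
def Weyl.z (K : Type*) {E : Type*} [Field K] (k : E →₀ ℤ) : Weyl K E :=
  k.support.noncommProd (fun e => Weyl.zpart K e (k e))
    (fun _ _ _ _ h => Weyl.zpart_commute h _ _)

end Weyl

end

end TGW

/-! ### Multiquivers -/

/-- A multiquiver with vertex set `V` and edge set `E`: every edge has at most one source and at
most one target (`none` stands for the absence of one), each with a positive multiplicity, there
are no loops, and every vertex is the source, and the target, of only finitely many edges. -/
structure Multiquiver (V E : Type*) where
  s : E → Option (V × ℕ+)
  t : E → Option (V × ℕ+)
  no_loops : ∀ e u m v n, s e = some (u, m) → t e = some (v, n) → u ≠ v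
  finite_s : ∀ v, {e | ∃ n, s e = some (v, n)}.Finite
  finite_t : ∀ v, {e | ∃ n, t e = some (v, n)}.Finite

namespace Multiquiver

noncomputable section

variable {V E : Type*}

open Classical in
/-- The multiplicity of the vertex `v` in an end of an edge: `n` if the end is `(v, n)`, and `0`
otherwise. -/
def mult (v : V) : Option (V × ℕ+) → ℤ
  | none => 0
  | some (w, n) => if w = v then (n : ℤ) else 0

theorem mult_ne_zero {v : V} {o : Option (V × ℕ+)} (h : mult v o ≠ 0) :
    ∃ n, o = some (v, n) := by
  rcases o with _ | ⟨w, n⟩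
  · simp [mult] at h
  · by_cases hw : w = v
    · exact ⟨n, by rw [hw]⟩
    · simp [mult, hw] at h

/-- The column `γ(v) ∈ ℤ E` of the incidence matrix: the coefficient at `e` is `n` if
`t(e) = (v, n)`, it is `-n` if `s(e) = (v, n)`, and `0` otherwise. -/
def γ (Γ : Multiquiver V E) (v : V) : E →₀ ℤ :=
  Finsupp.onFinset ((Γ.finite_t v).union (Γ.finite_s v)).toFinset
    (fun e => mult v (Γ.t e) - mult v (Γ.s e)) (by
      intro e he
      rw [Set.Finite.mem_toFinset]
      by_cases h : mult v (Γ.t e) = 0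
      · right
        refine mult_ne_zero (fun h' => he ?_)
        rw [h, h', sub_zero]
      · left
        exact mult_ne_zero h)

/-- The polynomial `u_e (u_e + 1) ⋯ (u_e + n - 1)` for `n ≥ 0`, and
`(u_e - 1) (u_e - 2) ⋯ (u_e - |n|)` for `n < 0`. -/
def uFactor (K : Type*) [Field K] (e : E) (n : ℤ) : MvPolynomial E K :=
  if 0 ≤ n then ∏ k ∈ Finset.range n.toNat, (MvPolynomial.X e + MvPolynomial.C (k : K))
  else ∏ k ∈ Finset.range (-n).toNat, (MvPolynomial.X e - MvPolynomial.C ((k : K) + 1))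

theorem X_add_C_ne_zero {K : Type*} [Field K] (e : E) (c : K) :
    (MvPolynomial.X e + MvPolynomial.C c : MvPolynomial E K) ≠ 0 := by
  intro h
  have := congrArg (MvPolynomial.eval fun _ => 1 - c) h
  simp at this

theorem uFactor_ne_zero (K : Type*) [Field K] (e : E) (n : ℤ) : uFactor K e n ≠ 0 := by
  unfold uFactor
  split_ifs
  · exact Finset.prod_ne_zero_iff.2 fun k _ => X_add_C_ne_zero e _
  · refine Finset.prod_ne_zero_iff.2 fun k _ => ?_
    rw [sub_eq_add_neg, ← map_neg]
    exact X_add_C_ne_zero e _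

/-- The automorphism `u_e ↦ u_e - k_e` of `R_E = K[u_e | e ∈ E]`. -/
def shift (K : Type*) [Field K] (k : E → ℤ) : MvPolynomial E K ≃ₐ[K] MvPolynomial E K :=
  AlgEquiv.ofAlgHom
    (MvPolynomial.aeval fun e => MvPolynomial.X e - MvPolynomial.C (k e : K))
    (MvPolynomial.aeval fun e => MvPolynomial.X e + MvPolynomial.C (k e : K))
    (by ext e; simp)
    (by ext e; simp)

theorem shift_X (K : Type*) [Field K] (k : E → ℤ) (e : E) :
    shift K k (MvPolynomial.X e) = MvPolynomial.X e - MvPolynomial.C (k e : K) := by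
  simp [shift]

theorem shift_comm (K : Type*) [Field K] (k l : E → ℤ) (r : MvPolynomial E K) :
    shift K k (shift K l r) = shift K l (shift K k r) := by
  have : ((shift K k).toAlgHom.comp (shift K l).toAlgHom) =
      ((shift K l).toAlgHom.comp (shift K k).toAlgHom) := by
    apply MvPolynomial.algHom_ext
    intro e
    simp [shift]
    ring
  exact DFunLike.congr_fun this r

/-- The twisted generalized Weyl datum `(R_E, σ^Γ, t^Γ)` of a multiquiver `Γ`:
`σ_v(u_e) = u_e - γ_{ev}` and `t_v = ∏_{e incident to v} u_{ev}`. -/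
def datum (K : Type*) [Field K] (Γ : Multiquiver V E) : TGW.Datum K (MvPolynomial E K) V where
  σ v := shift K (Γ.γ v)
  σ_comm _ _ := shift_comm K _ _
  t v := ∏ e ∈ (Γ.γ v).support, uFactor K e (Γ.γ v e)
  t_ne_zero _ := Finset.prod_ne_zero_iff.2 fun e _ => uFactor_ne_zero K e _
  t_central _ _ := mul_comm _ _

/-- The twisted generalized Weyl algebra `A(Γ)`, for which all `μ i j` are `1`. -/
abbrev algebra (K : Type*) [Field K] (Γ : Multiquiver V E) : Type _ :=
  TGW.Alg (Γ.datum K) (fun _ _ => 1)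

/-- `A(Γ)` as an `R_E`-ring with involution. -/
abbrev ringInvolution (K : Type*) [Field K] (Γ : Multiquiver V E) :
    TGW.RingInvolution (MvPolynomial E K) (Γ.algebra K) :=
  TGW.Alg.ringInvolution (Γ.datum K) (fun _ _ => 1) (fun _ _ _ => rfl)

/-- `ψ` is the canonical representation `φ_Γ : A(Γ) → A_E(K)` by differential operators: the map
of `R_E`-rings with involution with `X_v ↦ z^{γ(v)}` and `Y_v ↦ z^{-γ(v)}` (and `u_e ↦ y_e x_e`,
because it is a map of `R_E`-rings). Since `A(Γ)` is generated by `R_E` and the `X_v`, `Y_v`,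
these conditions determine `ψ`. -/
structure IsCanonicalRep {K : Type*} [Field K] (Γ : Multiquiver V E)
    (ψ : Γ.algebra K →+* TGW.Weyl K E) : Prop where
  isMap : (Γ.ringInvolution K).IsMap (TGW.Weyl.ringInvolution K E) ψ
  map_X : ∀ v, ψ (TGW.Alg.X _ _ v) = TGW.Weyl.z K (Γ.γ v)
  map_Y : ∀ v, ψ (TGW.Alg.Y _ _ v) = TGW.Weyl.z K (-Γ.γ v)

/-- `φ` factors as `φ_Γ ∘ ξ` for a map `ξ : A_μ(R_E, σ, t) → A(Γ)` of `ℤ V`-graded `R_E`-rings with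
involution. -/
def Factors {K : Type*} [Field K] {D : TGW.Datum K (MvPolynomial E K) V} {μ : V → V → K}
    (hμ : ∀ i j, i ≠ j → μ i j = μ j i) (φ : TGW.Alg D μ →+* TGW.Weyl K E)
    (Γ : Multiquiver V E) : Prop :=
  ∃ φΓ : Γ.algebra K →+* TGW.Weyl K E, Γ.IsCanonicalRep φΓ ∧
    ∃ ξ : TGW.Alg D μ →+* Γ.algebra K,
      (TGW.Alg.ringInvolution D μ hμ).IsMap (Γ.ringInvolution K) ξ ∧
      TGW.IsGradedMap ξ ∧ φΓ.comp ξ = φ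

end

end Multiquiver

/-! Write `τ_k` for the shift `u_e ↦ u_e - k_e`. The Weyl algebra is spanned over `R_E` by the
monomials `z^k`, and `z^k r = τ_k(r) z^k`. It acts on `R_E` with `x_e` a shift and `y_e x_e`
multiplication by `u_e`; then `z^k` acts as `h_k τ_k` with a nonzero polynomial `h_k`, which is
`zCoeff K k`. In characteristic zero the `τ_k` are distinct, so Dedekind's independence of
multiplicative maps into a domain makes the action faithful and shows that a nonzero `a` with `a r =
σ(r) a` forces `σ = τ_k` and `a = r z^k` (`Weyl.exists_eq_base_mul_z`).

The composite of `φ` with `ρ` is the injection `R_E → A_E(K)`, which gives consistency; with `t_i ≠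
0` it also gives `φ(X_i) ≠ 0`. Hence `φ(X_i) = r_i z^{k_i}` and, by the involution, `φ(Y_i) =
z^{-k_i} r_i`. The relation between `X_i` and `Y_j` becomes a polynomial identity `p τ_{k_i}(q) =
μ_ij q τ_{-k_j}(p)` with `p, q ≠ 0`. Shifts preserve top-degree parts, so `μ_ij = 1`
(`eq_one_of_mul_shift_eq`). If `k_i` and `k_j` had the same strict sign at `e`, then `u_e` would
divide `p q`, and the identity would push an integral root in `u_e` forever in one direction,
although there are only finitely many (`mul_shift_ne_of_dvd`). So the `k_i` are the columns of the
incidence matrix of a multiquiver `Γ`.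

The map `ξ` sends `X_i` to `r_i X_i` and `Y_i` to `Y_i r_i`. It descends to the quotient because
`φ_Γ` kills no nonzero homogeneous element: the degree-zero part of the construction is the image of
`R_E`, on which `φ_Γ` is injective. Uniqueness holds because a graded factorization through `A(Γ)`
forces `σ_v = τ_{γ(v)}`, and the columns `γ(v)` determine `Γ`. -/

namespace TGW

noncomputable section

open MvPolynomial Multiquiver

variable {K E : Type*} [Field K]

/-! ### The group of shifts of `R_E`. -/

theorem shift_C (k : E → ℤ) (c : K) : shift K k (C c) = C c :=
  (shift K k).commutes c

theorem shift_shift (k l : E → ℤ) (r : MvPolynomial E K) :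
    shift K k (shift K l r) = shift K (k + l) r := by
  have : ((shift K k).toAlgHom.comp (shift K l).toAlgHom) = (shift K (k + l)).toAlgHom := by
    apply MvPolynomial.algHom_ext
    intro e
    simp [shift]
    ring
  exact DFunLike.congr_fun this r

theorem shift_zero (r : MvPolynomial E K) : shift K (0 : E → ℤ) r = r := by
  have : (shift K (0 : E → ℤ)).toAlgHom = AlgHom.id K _ := by
    apply MvPolynomial.algHom_ext
    intro e
    simp [shift]
  exact DFunLike.congr_fun this r

theorem shift_shift_neg (k : E → ℤ) (r : MvPolynomial E K) :
    shift K k (shift K (-k) r) = r := by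
  rw [shift_shift, add_neg_cancel, shift_zero]

theorem shift_symm (k : E → ℤ) (r : MvPolynomial E K) :
    (shift K k).symm r = shift K (-k) r := by
  rw [AlgEquiv.symm_apply_eq, shift_shift_neg]

theorem shift_injective [CharZero K] {k l : E → ℤ}
    (h : ∀ r : MvPolynomial E K, shift K k r = shift K l r) : k = l := by
  funext e
  have := h (X e)
  rw [shift_X, shift_X, sub_right_inj] at this
  exact_mod_cast C_injective E K this

namespace Weyl

/-! ### Commutation with the torus -/

theorem base_C (c : K) : base K E (C c) = algebraMap K _ c := (base K E).commutes c

/-- An element that normalizes the variables by a shift normalizes `R_E` by this shift. -/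
theorem mul_base_of_mul_X {w : Weyl K E} {k : E → ℤ}
    (h : ∀ e, w * base K E (X e) = base K E (X e - C (k e : K)) * w) (r : MvPolynomial E K) :
    w * base K E r = base K E (shift K k r) * w := by
  induction r using MvPolynomial.induction_on with
  | C c => rw [shift_C, base_C, Algebra.commutes]
  | add p q hp hq => rw [map_add, map_add, map_add, mul_add, add_mul, hp, hq]
  | mul_X p e hp =>
    rw [map_mul, ← mul_assoc, hp, mul_assoc, h, map_mul, map_mul, shift_X, mul_assoc]

theorem x_mul_base (e : E) (r : MvPolynomial E K) :
    x K e * base K E r = base K E (shift K (Finsupp.single e (1 : ℤ)) r) * x K e := by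
  refine mul_base_of_mul_X (fun f => ?_) r
  by_cases h : e = f
  · subst h
    rw [Finsupp.single_eq_same, map_sub, base_C, base_X, y_mul_x]
    simp [mul_assoc, y_mul_x]
  · rw [Finsupp.single_eq_of_ne (Ne.symm h), base_X]
    simp only [Int.cast_zero, map_zero, sub_zero, base_X]
    rw [← mul_assoc, ← y_mul_x_ne (Ne.symm h), mul_assoc, x_mul_x, mul_assoc]

theorem y_mul_base (e : E) (r : MvPolynomial E K) :
    y K e * base K E r = base K E (shift K (Finsupp.single e (-1 : ℤ)) r) * y K e := by
  refine mul_base_of_mul_X (fun f => ?_) r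
  by_cases h : e = f
  · subst h
    rw [Finsupp.single_eq_same, map_sub, base_C, base_X]
    conv_lhs => rw [y_mul_x, mul_add, mul_one, ← mul_assoc]
    simp [add_mul]
  · rw [Finsupp.single_eq_of_ne (Ne.symm h), base_X]
    simp only [Int.cast_zero, map_zero, sub_zero, base_X]
    rw [← mul_assoc, y_mul_y, mul_assoc, y_mul_x_ne h, mul_assoc]

theorem pow_mul_base {w : Weyl K E} {k : E → ℤ}
    (h : ∀ r, w * base K E r = base K E (shift K k r) * w) (n : ℕ) (r : MvPolynomial E K) :
    w ^ n * base K E r = base K E (shift K (n • k) r) * w ^ n := by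
  induction n generalizing r with
  | zero => simp [shift_zero]
  | succ n ih =>
    rw [pow_succ, mul_assoc, h, ← mul_assoc, ih, mul_assoc, shift_shift, succ_nsmul]

theorem zpart_mul_base (e : E) (n : ℤ) (r : MvPolynomial E K) :
    zpart K e n * base K E r = base K E (shift K (Finsupp.single e n) r) * zpart K e n := by
  unfold zpart
  split_ifs with h
  · rw [pow_mul_base (x_mul_base e)]
    congr 4
    rw [← Finsupp.coe_smul, Finsupp.smul_single]
    simp [h]
  · rw [pow_mul_base (y_mul_base e)]
    congr 4
    rw [← Finsupp.coe_smul, Finsupp.smul_single]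
    congr 2
    simp only [smul_neg, nsmul_eq_mul, mul_one]
    omega

theorem zpart_zero (e : E) : zpart K e 0 = 1 := by simp [zpart]

theorem z_zero : z K (0 : E →₀ ℤ) = 1 := by
  simp [z]

/-- Peels one edge off the noncommutative product; this is the inductive step for all later
computations with `z^k`. -/
theorem z_single_add {e : E} {n : ℤ} {k : E →₀ ℤ} (he : e ∉ k.support) :
    z K (Finsupp.single e n + k) = zpart K e n * z K k := by
  classical
  by_cases hn : n = 0
  · subst hn; simp [zpart_zero]
  have hs : (Finsupp.single e n + k).support = insert e k.support := by
    ext f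
    by_cases h : f = e
    · subst h; simp_all
    · simp [h]
  unfold z
  refine (Finset.noncommProd_congr hs (fun _ _ => rfl) _).trans ?_
  refine (Finset.noncommProd_insert_of_notMem _ _ _ _ he).trans ?_
  congr 1
  · simp_all
  · refine Finset.noncommProd_congr rfl (fun f hf => ?_) _
    have : f ≠ e := fun h => he (h ▸ hf)
    simp [this]

theorem z_eq_zpart_mul (e : E) (k : E →₀ ℤ) :
    z K k = zpart K e (k e) * z K (k.erase e) := by
  rw [← z_single_add (by simp), Finsupp.single_add_erase]

theorem z_mul_base (k : E →₀ ℤ) (r : MvPolynomial E K) :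
    z K k * base K E r = base K E (shift K k r) * z K k := by
  induction k using Finsupp.induction generalizing r with
  | zero => simp [z_zero, shift_zero]
  | single_add e n k he _ ih =>
    rw [z_single_add he, mul_assoc, ih, ← mul_assoc, zpart_mul_base, mul_assoc, shift_shift,
      Finsupp.coe_add]

theorem zpart_commute_z {e : E} {k : E →₀ ℤ} (he : e ∉ k.support) (n : ℤ) :
    Commute (zpart K e n) (z K k) := by
  refine Finset.noncommProd_commute _ _ _ _ (fun f hf => zpart_commute ?_ _ _)
  rintro rfl
  exact he hf

theorem zpart_commute_of_nonneg {e : E} {m n : ℤ} (h : 0 ≤ m * n) :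
    Commute (zpart K e m) (zpart K e n) := by
  by_cases hm : m = 0
  · subst hm; rw [zpart_zero]; exact Commute.one_left _
  by_cases hn : n = 0
  · subst hn; rw [zpart_zero]; exact Commute.one_right _
  unfold zpart
  split_ifs with h1 h2 h2
  · exact (Commute.refl _).pow_pow _ _
  · exact absurd h (not_le.2 (mul_neg_of_pos_of_neg (by omega) (by omega)))
  · exact absurd h (not_le.2 (mul_neg_of_neg_of_pos (by omega) (by omega)))
  · exact (Commute.refl _).pow_pow _ _

/-- Generators of different edges commute, and on a common edge the sign condition means that both
factors are powers of the same generator, `x_e` or `y_e`. -/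
theorem z_commute {k l : E →₀ ℤ} (h : ∀ e, 0 ≤ k e * l e) : Commute (z K k) (z K l) := by
  refine Finset.noncommProd_commute _ _ _ _ (fun f _ => Commute.symm ?_)
  refine Finset.noncommProd_commute _ _ _ _ (fun e _ => Commute.symm ?_)
  by_cases hef : e = f
  · subst hef; exact zpart_commute_of_nonneg (h e)
  · exact zpart_commute hef _ _

/-! ### The involution on monomials -/

theorem inv_one : inv K E 1 = 1 := by
  simpa using inv_algebraMap (K := K) (E := E) 1

theorem inv_pow (a : Weyl K E) (n : ℕ) : inv K E (a ^ n) = inv K E a ^ n := by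
  induction n with
  | zero => simp [inv_one]
  | succ n ih => rw [pow_succ, inv_mul, ih, pow_succ']

theorem inv_zpart (e : E) (n : ℤ) : inv K E (zpart K e n) = zpart K e (-n) := by
  rcases lt_trichotomy n 0 with h | rfl | h
  · rw [zpart, if_neg (by omega), zpart, if_pos (by omega), inv_pow, inv_y]
  · rw [neg_zero, zpart_zero, inv_one]
  · rw [zpart, if_pos (by omega), zpart, if_neg (by omega), inv_pow, inv_x, neg_neg]

theorem inv_z (k : E →₀ ℤ) : inv K E (z K k) = z K (-k) := by
  induction k using Finsupp.induction with
  | zero => simp [z_zero, inv_one]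
  | single_add e n k he _ ih =>
    have he' : e ∉ (-k).support := by rwa [Finsupp.support_neg]
    rw [z_single_add he, inv_mul, ih, inv_zpart, neg_add, ← Finsupp.single_neg,
      z_single_add he', (zpart_commute_z he' _).eq]

theorem zpart_neg_mul_zpart (e : E) (n : ℤ) :
    zpart K e (-n) * zpart K e n = base K E (uFactor K e n) := by
  have hy (m : ℕ) : y K e ^ m * x K e ^ m =
      base K E (∏ k ∈ Finset.range m, (X e + C (k : K))) := by
    induction m with
    | zero => simp
    | succ m ih =>
      -- The innermost `y x` is `u_e`; moving it left past `y ^ m` turns it into the new factor `u_e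
      -- + m`.
      rw [pow_succ, pow_succ', mul_assoc, ← mul_assoc (y K e) (x K e), ← base_X, ← mul_assoc,
        pow_mul_base (y_mul_base e), mul_assoc, ih, ← map_mul, Finset.prod_range_succ, mul_comm,
        shift_X]
      simp
  have hx (m : ℕ) : x K e ^ m * y K e ^ m =
      base K E (∏ k ∈ Finset.range m, (X e - C ((k : K) + 1))) := by
    induction m with
    | zero => simp
    | succ m ih =>
      -- In this order the innermost product is `u_e - 1`, and passing `x ^ m` gives `u_e - (m +
      -- 1)`: hence the offset by one.
      have h1 : x K e * y K e = base K E (X e - 1) := by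
        rw [map_sub, base_X, map_one, y_mul_x, add_sub_cancel_right]
      rw [pow_succ, pow_succ' (y K e), mul_assoc, ← mul_assoc (x K e) (y K e), h1, ← mul_assoc,
        pow_mul_base (x_mul_base e), mul_assoc, ih, ← map_mul, Finset.prod_range_succ, mul_comm,
        map_sub, map_one, shift_X]
      simp [sub_sub]
  rcases lt_trichotomy n 0 with h | rfl | h
  · rw [zpart, if_pos (by omega), zpart, if_neg (by omega), uFactor, if_neg (by omega), hx]
  · simp [zpart_zero, uFactor]
  · rw [zpart, if_neg (by omega), zpart, if_pos (by omega), uFactor, if_pos (by omega), neg_neg, hy]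

theorem z_neg_mul_z (k : E →₀ ℤ) :
    z K (-k) * z K k = base K E (∏ e ∈ k.support, uFactor K e (k e)) := by
  change _ = base K E (k.prod fun e n => uFactor K e n)
  induction k using Finsupp.induction with
  | zero => simp [z_zero]
  | single_add e n k he hn ih =>
    have he' : e ∉ (-k).support := by rwa [Finsupp.support_neg]
    have h0 (e : E) : uFactor K e 0 = 1 := by simp [uFactor]
    rw [Finsupp.prod_add_index_of_disjoint, Finsupp.prod_single_index (h0 e), map_mul, ← ih,
      ← zpart_neg_mul_zpart, z_single_add he, neg_add, ← Finsupp.single_neg, z_single_add he',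
      mul_assoc, ← mul_assoc (z K (-k)), ← (zpart_commute_z he' n).eq]
    · simp only [mul_assoc]
    · rw [Finsupp.support_single _ hn]
      simpa using he

/-! ### Spanning by `r z^k` -/

/-- Either the power of `x_e` grows, with `q = 1`, or `x_e` meets a `y_e` and leaves `x_e y_e = u_e
- 1`. -/
theorem x_mul_zpart (e : E) (n : ℤ) :
    ∃ q, x K e * zpart K e n = base K E q * zpart K e (n + 1) := by
  by_cases h : 0 ≤ n
  · refine ⟨1, ?_⟩
    rw [zpart, if_pos h, zpart, if_pos (by omega), map_one, one_mul, ← pow_succ']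
    congr 1; omega
  · refine ⟨X e - 1, ?_⟩
    have h1 : x K e * y K e = base K E (X e - 1) := by
      rw [map_sub, base_X, map_one, y_mul_x, add_sub_cancel_right]
    have h2 : zpart K e n = y K e * zpart K e (n + 1) := by
      rcases eq_or_ne n (-1) with rfl | h'
      · simp [zpart]
      · rw [zpart, if_neg h, zpart, if_neg (by omega), ← pow_succ']
        congr 1; omega
    rw [h2, ← mul_assoc, h1]

theorem y_mul_zpart (e : E) (n : ℤ) :
    ∃ q, y K e * zpart K e n = base K E q * zpart K e (n - 1) := by
  by_cases h : n ≤ 0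
  · refine ⟨1, ?_⟩
    rcases eq_or_ne n 0 with rfl | h'
    · simp [zpart]
    rw [zpart, if_neg (by omega), zpart, if_neg (by omega), map_one, one_mul, ← pow_succ']
    congr 1; omega
  · refine ⟨X e, ?_⟩
    rw [zpart, if_pos (by omega), zpart, if_pos (by omega), base_X, mul_assoc, ← pow_succ']
    congr 2; omega

theorem zpart_mul_z_erase (e : E) (n : ℤ) (k : E →₀ ℤ) :
    zpart K e n * z K (k.erase e) = z K (Finsupp.single e n + k.erase e) :=
  (z_single_add (by simp)).symm

/-- The span contains `1` and is stable under left multiplication by every `x_e` and `y_e`, hence by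
the whole algebra. -/
theorem mem_span_base_mul_z (a : Weyl K E) :
    a ∈ Submodule.span K {b | ∃ r k, b = base K E r * z K k} := by
  set N := Submodule.span K {b | ∃ r k, b = base K E r * z K (k : E →₀ ℤ)} with hN
  have key (w : Weyl K E) (hw : ∀ r k, w * (base K E r * z K k) ∈ N) (a) (ha : a ∈ N) :
      w * a ∈ N := by
    rw [hN] at ha
    induction ha using Submodule.span_induction with
    | mem b hb => obtain ⟨r, k, rfl⟩ := hb; exact hw r k
    | zero => simp
    | add b c _ _ hb hc => rw [mul_add]; exact add_mem hb hc
    | smul c b _ hb => rw [mul_smul_comm]; exact N.smul_mem c hb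
  have hx (e : E) : ∀ a ∈ N, x K e * a ∈ N := key _ fun r k => by
    obtain ⟨q, hq⟩ := x_mul_zpart (K := K) e (k e)
    refine Submodule.subset_span ⟨shift K (Finsupp.single e (1 : ℤ)) r * q,
      Finsupp.single e (k e + 1) + k.erase e, ?_⟩
    rw [z_eq_zpart_mul e, ← mul_assoc, x_mul_base, mul_assoc, ← mul_assoc (x K e), hq, mul_assoc,
      zpart_mul_z_erase, map_mul, mul_assoc]
  have hy (e : E) : ∀ a ∈ N, y K e * a ∈ N := key _ fun r k => by
    obtain ⟨q, hq⟩ := y_mul_zpart (K := K) e (k e)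
    refine Submodule.subset_span ⟨shift K (Finsupp.single e (-1 : ℤ)) r * q,
      Finsupp.single e (k e - 1) + k.erase e, ?_⟩
    rw [z_eq_zpart_mul e, ← mul_assoc, y_mul_base, mul_assoc, ← mul_assoc (y K e), hq, mul_assoc,
      zpart_mul_z_erase, map_mul, mul_assoc]
  have h1 : (1 : Weyl K E) ∈ N := Submodule.subset_span ⟨1, 0, by simp [z_zero]⟩
  suffices ∀ b ∈ N, a * b ∈ N by simpa using this 1 h1
  obtain ⟨a, rfl⟩ := mk_surjective a
  induction a using FreeAlgebra.induction with
  | grade0 c =>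
    intro b hb
    rw [AlgHom.commutes, ← Algebra.smul_def]
    exact N.smul_mem c hb
  | grade1 g =>
    cases g with
    | x e => exact hx e
    | y e => exact hy e
  | mul a b ha hb =>
    intro c hc
    rw [map_mul, mul_assoc]
    exact ha _ (hb _ hc)
  | add a b ha hb =>
    intro c hc
    rw [map_add, add_mul]
    exact add_mem (ha _ hc) (hb _ hc)

theorem exists_eq_sum (a : Weyl K E) : ∃ c : (E →₀ ℤ) →₀ MvPolynomial E K,
    a = c.sum fun k r => base K E r * z K k := by
  classical
  have ha := mem_span_base_mul_z a
  induction ha using Submodule.span_induction with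
  | mem b hb => obtain ⟨r, k, rfl⟩ := hb; exact ⟨Finsupp.single k r, by simp⟩
  | zero => exact ⟨0, by simp⟩
  | add b c _ _ hb hc =>
    obtain ⟨f, rfl⟩ := hb
    obtain ⟨g, rfl⟩ := hc
    refine ⟨f + g, ?_⟩
    rw [Finsupp.sum_add_index'] <;> simp [add_mul]
  | smul s b _ hb =>
    obtain ⟨f, rfl⟩ := hb
    refine ⟨s • f, ?_⟩
    rw [Finsupp.sum_smul_index' (by simp), Finsupp.smul_sum]
    simp

/-! ### The action on `R_E` by shift operators -/

/-- The operators on `R_E` by which the generators of the Weyl algebra act. -/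
def actGen (K : Type*) {E : Type*} [Field K] : WeylGen E → Module.End K (MvPolynomial E K)
  | .x e => (shift K (Finsupp.single e (1 : ℤ))).toLinearMap
  | .y e => LinearMap.mulLeft K (X e) * (shift K (Finsupp.single e (-1 : ℤ))).toLinearMap

theorem actGen_rel ⦃a b : FreeAlgebra K (WeylGen E)⦄ (h : WeylRel K E a b) :
    FreeAlgebra.lift K (actGen K) a = FreeAlgebra.lift K (actGen K) b := by
  have hne {e f : E} (h : e ≠ f) (n : ℤ) :
      shift K (Finsupp.single e n) (X f) = (X f : MvPolynomial E K) := by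
    rw [shift_X, Finsupp.single_eq_of_ne h.symm]; simp
  refine LinearMap.ext fun p => ?_
  induction h with
  | xx e f => simp [actGen, shift_comm K (Finsupp.single e (1 : ℤ))]
  | yy e f =>
    by_cases hef : e = f
    · rw [hef]
    · simp only [actGen, map_mul, FreeAlgebra.lift_ι_apply, Module.End.mul_apply,
        LinearMap.mulLeft_apply, AlgEquiv.toLinearMap_apply, hne hef, hne (Ne.symm hef)]
      rw [shift_comm K (Finsupp.single e (-1 : ℤ)), mul_left_comm]
  | yx e =>
    simp [actGen, shift_shift, shift_X, shift_zero]
    ring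
  | yx_ne e f h =>
    simp [actGen, shift_comm K (Finsupp.single f (1 : ℤ)), hne h.symm]

/-- The action of the Weyl algebra on `R_E` in which `x_e` is the shift `u_e ↦ u_e - 1` and
`y_e x_e` is multiplication by `u_e`. -/
def act (K E : Type*) [Field K] : Weyl K E →ₐ[K] Module.End K (MvPolynomial E K) :=
  RingQuot.liftAlgHom K ⟨FreeAlgebra.lift K (actGen K), actGen_rel⟩

theorem act_mk (a : FreeAlgebra K (WeylGen E)) :
    act K E (mk K E a) = FreeAlgebra.lift K (actGen K) a :=
  RingQuot.liftAlgHom_mkAlgHom_apply K _ (s := WeylRel K E) actGen_rel a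

theorem act_x (e : E) (p : MvPolynomial E K) :
    act K E (x K e) p = shift K (Finsupp.single e (1 : ℤ)) p := by
  rw [x, act_mk, FreeAlgebra.lift_ι_apply]; rfl

theorem act_y (e : E) (p : MvPolynomial E K) :
    act K E (y K e) p = X e * shift K (Finsupp.single e (-1 : ℤ)) p := by
  rw [y, act_mk, FreeAlgebra.lift_ι_apply]; rfl

theorem act_base (r p : MvPolynomial E K) : act K E (base K E r) p = r * p := by
  induction r using MvPolynomial.induction_on generalizing p with
  | C c => rw [base_C, AlgHom.commutes, Module.algebraMap_end_apply, C_mul']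
  | add q r hq hr => rw [map_add, map_add, LinearMap.add_apply, hq, hr, add_mul]
  | mul_X q e hq =>
    rw [map_mul, map_mul, Module.End.mul_apply, hq, base_X, map_mul, Module.End.mul_apply, act_y,
      act_x, shift_shift, ← Finsupp.coe_add, ← Finsupp.single_add, mul_assoc]
    simp [shift_zero]

/-- The image of `r` acts as multiplication by `r`, so its value at `1` recovers `r`. -/
theorem base_injective : Function.Injective (base K E) := fun r s h => by
  have := congrArg (fun w => act K E w 1) h
  simpa [act_base] using this

/-- The polynomial `h_k` for which `z^k` acts as `h_k` times the shift by `k`. -/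
def zCoeff (K : Type*) {E : Type*} [Field K] (k : E →₀ ℤ) : MvPolynomial E K := act K E (z K k) 1

/-- Evaluate `z^k p = τ_k(p) z^k` at `1`. -/
theorem act_z (k : E →₀ ℤ) (p : MvPolynomial E K) :
    act K E (z K k) p = zCoeff K k * shift K k p := by
  have := congrArg (fun w => act K E w 1) (z_mul_base k p)
  simpa [act_base, mul_comm, zCoeff] using this

/-- If `h_k` vanished, so would `z^{-k} z^k`, which acts as multiplication by a nonzero product of
linear factors. -/
theorem zCoeff_ne_zero (k : E →₀ ℤ) : zCoeff K k ≠ 0 := by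
  intro h
  have := congrArg (fun w => act K E w 1) (z_neg_mul_z (K := K) k)
  simp only [map_mul, Module.End.mul_apply, act_z, h, zero_mul, map_zero, act_base,
    mul_one] at this
  exact Finset.prod_ne_zero_iff.2 (fun e _ => uFactor_ne_zero K e (k e)) this.symm

/-- A leading `y_e` can be split off `z^k`, and `y_e` acts by a shift followed by multiplication by
`u_e`. -/
theorem X_dvd_zCoeff {e : E} {k : E →₀ ℤ} (h : k e < 0) : X e ∣ zCoeff K k := by
  have hz : zpart K e (k e) = y K e * y K e ^ ((-k e).toNat - 1) := by
    rw [zpart, if_neg (by omega), ← pow_succ']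
    congr 1; omega
  rw [zCoeff, z_eq_zpart_mul e, hz, mul_assoc, map_mul, Module.End.mul_apply, act_y]
  exact dvd_mul_right _ _

theorem act_z_injective (k : E →₀ ℤ) : Function.Injective (act K E (z K k)) := by
  rw [injective_iff_map_eq_zero]
  intro p hp
  rw [act_z] at hp
  have := (mul_eq_zero.1 hp).resolve_left (zCoeff_ne_zero k)
  exact (map_eq_zero_iff _ (shift K k).injective).1 this

/-- `z_neg_mul_z` at `-k` already places this product in `R_E`. Bracketing `z^k z^{-k} z^k` in two
ways, applying both to `1` and cancelling `h_k` gives it the form required by the relation `X_i Y_i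
= σ_i(t_i)`. -/
theorem z_mul_z_neg (k : E →₀ ℤ) :
    z K k * z K (-k) = base K E (shift K k (∏ e ∈ k.support, uFactor K e (k e))) := by
  have h1 := z_neg_mul_z (K := K) (-k)
  rw [neg_neg] at h1
  have h2 : (z K k * z K (-k)) * z K k = z K k * (z K (-k) * z K k) := mul_assoc _ _ _
  rw [h1, z_neg_mul_z, z_mul_base] at h2
  have h3 := congrArg (fun w => act K E w 1) h2
  simp only [map_mul, Module.End.mul_apply, act_base, act_z, map_one, mul_one] at h3
  rw [h1, mul_right_cancel₀ (zCoeff_ne_zero k) h3]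

/-- The coefficients, in terms of shift operators, of the operator by which `∑ c_k z^k` acts. -/
def shiftCoeff (c : (E →₀ ℤ) →₀ MvPolynomial E K) : (E →₀ ℤ) →₀ MvPolynomial E K :=
  Finsupp.onFinset c.support (fun k => c k * zCoeff K k) fun _ hk =>
    Finsupp.mem_support_iff.2 (left_ne_zero_of_mul hk)

theorem shiftCoeff_apply (c : (E →₀ ℤ) →₀ MvPolynomial E K) (k : E →₀ ℤ) :
    shiftCoeff c k = c k * zCoeff K k := rfl

theorem shiftCoeff_zero : shiftCoeff (0 : (E →₀ ℤ) →₀ MvPolynomial E K) = 0 := by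
  ext1 k
  exact zero_mul _

theorem shiftCoeff_injective : Function.Injective (shiftCoeff (K := K) (E := E)) :=
  fun _ _ h => by
    ext1 k
    exact mul_right_cancel₀ (zCoeff_ne_zero k) (DFunLike.congr_fun h k)

theorem linearCombination_shiftCoeff (c : (E →₀ ℤ) →₀ MvPolynomial E K) :
    Finsupp.linearCombination (MvPolynomial E K)
      (fun k : E →₀ ℤ => (shift K k : MvPolynomial E K → MvPolynomial E K)) (shiftCoeff c) =
      act K E (c.sum fun k r => base K E r * z K k) := by
  funext p
  rw [Finsupp.linearCombination_apply, shiftCoeff, Finsupp.onFinset_sum _ (by simp)]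
  simp only [Finsupp.sum, map_sum, LinearMap.sum_apply, map_mul, Module.End.mul_apply, act_base,
    act_z, mul_assoc, Finset.sum_apply, Pi.smul_apply, smul_eq_mul]

/-! ### Faithfulness of the action and the elements that normalize `R_E`. -/

section CharZero

variable [CharZero K]

theorem shift_monoidHom_injective : Function.Injective
    (fun k : E →₀ ℤ => (shift K k : MvPolynomial E K →* MvPolynomial E K)) := by
  intro _ _ h
  exact DFunLike.coe_injective (shift_injective (K := K) fun r => DFunLike.congr_fun h r)

/-- If `∑ c_k z^k` acts as zero, then `∑ c_k h_k τ_k = 0`; Dedekind independence gives `c_k h_k =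
0`, and `h_k ≠ 0`. -/
theorem act_injective : Function.Injective (act K E) := by
  rw [injective_iff_map_eq_zero]
  intro a ha
  obtain ⟨c, rfl⟩ := exists_eq_sum a
  have hli := (linearIndependent_monoidHom (MvPolynomial E K) (MvPolynomial E K)).comp _
    (shift_monoidHom_injective (K := K) (E := E))
  have h := linearCombination_shiftCoeff c
  rw [ha] at h
  have h0 : shiftCoeff c = shiftCoeff 0 := by
    refine hli (h.trans ?_)
    rw [shiftCoeff_zero, map_zero]
    rfl
  rw [shiftCoeff_injective h0, Finsupp.sum_zero_index]

theorem eq_zero_of_base_mul_eq_zero {r : MvPolynomial E K} (hr : r ≠ 0) {a : Weyl K E}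
    (h : base K E r * a = 0) : a = 0 := by
  refine act_injective ((LinearMap.ext fun p => ?_).trans (map_zero _).symm)
  have := congrArg (fun w => act K E w p) h
  simp only [map_mul, Module.End.mul_apply, act_base, map_zero, LinearMap.zero_apply] at this
  exact (mul_eq_zero.1 this).resolve_left hr

theorem eq_zero_of_z_mul_eq_zero {k : E →₀ ℤ} {a : Weyl K E} (h : z K k * a = 0) : a = 0 := by
  refine act_injective ((LinearMap.ext fun p => ?_).trans (map_zero _).symm)
  have := congrArg (fun w => act K E w p) h
  rw [map_mul, Module.End.mul_apply, map_zero, LinearMap.zero_apply] at this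
  exact (map_eq_zero_iff _ (act_z_injective k)).1 this

/-- An element of the Weyl algebra normalizing `R_E` is of the form `r z^k`. -/
theorem exists_eq_base_mul_z {a : Weyl K E} (ha : a ≠ 0)
    (σ : MvPolynomial E K ≃ₐ[K] MvPolynomial E K)
    (h : ∀ r, a * base K E r = base K E (σ r) * a) :
    ∃ (k : E →₀ ℤ) (r : MvPolynomial E K), σ = shift K k ∧ a = base K E r * z K k := by
  classical
  obtain ⟨c, hc⟩ := exists_eq_sum a
  -- Normalization alone makes `a` act as a polynomial times `σ`, to be compared with `∑ c_k h_k
  -- τ_k`.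
  have hact (p) : act K E a p = act K E a 1 * σ p := by
    have := congrArg (fun w => act K E w 1) (h p)
    simpa [act_base, mul_comm] using this
  have hR : act K E a 1 ≠ 0 := fun h0 => ha <| act_injective <| by
    rw [map_zero]
    refine LinearMap.ext fun p => ?_
    rw [hact, h0, zero_mul, LinearMap.zero_apply]
  have hli := linearIndependent_monoidHom (MvPolynomial E K) (MvPolynomial E K)
  -- Independence is applied among all multiplicative maps, because `σ` is not yet known to be a
  -- shift.
  have key : Finsupp.mapDomain
      (fun k : E →₀ ℤ => (shift K k : MvPolynomial E K →* MvPolynomial E K)) (shiftCoeff c) =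
      Finsupp.single (σ : MvPolynomial E K →* MvPolynomial E K) (act K E a 1) := by
    refine hli ?_
    rw [Finsupp.linearCombination_mapDomain, Finsupp.linearCombination_single]
    refine (linearCombination_shiftCoeff c).trans ?_
    rw [← hc]
    exact funext hact
  obtain ⟨k, -, hk⟩ : ∃ k ∈ (shiftCoeff c).support,
      (shift K k : MvPolynomial E K →* MvPolynomial E K) = σ := by
    refine Finset.mem_image.1 (Finsupp.mapDomain_support ?_)
    rw [key, Finsupp.support_single _ hR]
    exact Finset.mem_singleton_self _
  refine ⟨k, c k, AlgEquiv.ext fun r => (DFunLike.congr_fun hk r).symm, ?_⟩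
  -- With `σ = τ_k` both sides are pushforwards along the injection `k ↦ τ_k`, so the coefficients
  -- are concentrated at `k`.
  rw [← hk, ← Finsupp.mapDomain_single (f := fun k : E →₀ ℤ =>
    (shift K k : MvPolynomial E K →* MvPolynomial E K))] at key
  have hs := Finsupp.mapDomain_injective shift_monoidHom_injective key
  have hc' : c = Finsupp.single k (c k) := by
    ext1 l
    by_cases hl : l = k
    · rw [hl, Finsupp.single_eq_same]
    · have := DFunLike.congr_fun hs l
      rw [shiftCoeff_apply, Finsupp.single_eq_of_ne hl] at this
      rw [Finsupp.single_eq_of_ne hl]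
      exact (mul_eq_zero.1 this).resolve_right (zCoeff_ne_zero l)
  rw [hc, hc', Finsupp.sum_single_index (by simp), Finsupp.single_eq_same]

end CharZero

end Weyl

end

end TGW

namespace TGW

noncomputable section

open MvPolynomial Multiquiver

variable {K E : Type*} [Field K]

/-! ### Shifts preserve the top degree part -/

/-- Multiplying by one more variable, the difference becomes `(τ p - p)(u_e - k_e) - k_e p`, of
degree at most `deg p`. The alternative of vanishing is needed since zero has total degree `0`, like
the constants. -/
theorem shift_monomial_sub_eq_zero_or_totalDegree_lt (k : E → ℤ) (s : E →₀ ℕ) (a : K) :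
    shift K k (monomial s a) - monomial s a = 0 ∨
      (shift K k (monomial s a) - monomial s a).totalDegree < (monomial s a).totalDegree := by
  revert s a
  refine induction_on_monomial (fun a => ?_) fun p e ih => ?_
  · left; rw [shift_C, sub_self]
  · by_cases hp : p = 0
    · left; simp [hp]
    right
    have h1 : (p * X e).totalDegree = p.totalDegree + 1 := by
      rw [totalDegree_mul_of_isDomain hp (X_ne_zero e), totalDegree_X]
    have h2 : shift K k (p * X e) - p * X e =
        (shift K k p - p) * (X e - C (k e : K)) - p * C (k e : K) := by
      rw [map_mul, shift_X]; ring
    have h3 : ((shift K k p - p) * (X e - C (k e : K))).totalDegree ≤ p.totalDegree := by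
      rcases ih with h | h
      · simp [h]
      · refine (totalDegree_mul _ _).trans ?_
        have : (X e - C (k e : K)).totalDegree ≤ 1 := by
          refine (totalDegree_sub _ _).trans ?_
          rw [totalDegree_X, totalDegree_C]
          exact max_le le_rfl zero_le_one
        omega
    have h4 : (p * C (k e : K)).totalDegree ≤ p.totalDegree := by
      refine (totalDegree_mul _ _).trans ?_
      rw [totalDegree_C, add_zero]
    rw [h1, h2, Nat.lt_succ_iff]
    exact (totalDegree_sub _ _).trans (max_le h3 h4)

theorem shift_sub_eq_zero_or_totalDegree_lt (k : E → ℤ) (p : MvPolynomial E K) :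
    shift K k p - p = 0 ∨ (shift K k p - p).totalDegree < p.totalDegree := by
  rcases Nat.eq_zero_or_pos p.totalDegree with h0 | h0
  · left
    rw [totalDegree_eq_zero_iff_eq_C.1 h0, shift_C, sub_self]
  · right
    have h : shift K k p - p =
        ∑ s ∈ p.support, (shift K k (monomial s (p.coeff s)) - monomial s (p.coeff s)) := by
      rw [Finset.sum_sub_distrib, ← map_sum, support_sum_monomial_coeff]
    rw [h]
    refine (totalDegree_finsetSum _ _).trans_lt ((Finset.sup_lt_iff h0).2 fun s hs => ?_)
    have hle : (monomial s (p.coeff s)).totalDegree ≤ p.totalDegree :=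
      (totalDegree_monomial_le _ _).trans (le_totalDegree hs)
    rcases shift_monomial_sub_eq_zero_or_totalDegree_lt k s (p.coeff s) with h | h
    · rwa [h, totalDegree_zero]
    · exact h.trans_le hle

/-- The two sides have top-degree parts equal to those of `p q` and `μ p q`. -/
theorem eq_one_of_mul_shift_eq {p q : MvPolynomial E K} (hp : p ≠ 0) (hq : q ≠ 0) {k l : E → ℤ}
    {μ : K} (h : p * shift K k q = C μ * (q * shift K l p)) : μ = 1 := by
  by_contra hμ
  -- For `μ ≠ 1` the left side has degree `deg p + deg q`, while each term on the right is zero or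
  -- of smaller degree.
  have h1 : C (1 - μ) * (p * q) =
      C μ * (q * (shift K l p - p)) - p * (shift K k q - q) := by
    rw [mul_sub, mul_sub, mul_sub, ← h, map_sub, map_one]
    ring
  have hC : (C (1 - μ) : MvPolynomial E K) ≠ 0 := by
    rw [Ne, C_eq_zero]; exact sub_ne_zero.2 (Ne.symm hμ)
  have hne : C (1 - μ) * (p * q) ≠ 0 := mul_ne_zero hC (mul_ne_zero hp hq)
  have hdeg : (C (1 - μ) * (p * q)).totalDegree = p.totalDegree + q.totalDegree := by
    rw [totalDegree_mul_of_isDomain hC (mul_ne_zero hp hq), totalDegree_mul_of_isDomain hp hq,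
      totalDegree_C, zero_add]
  rw [h1] at hne hdeg
  have hA : (C μ * (q * (shift K l p - p))).totalDegree ≤
      q.totalDegree + (shift K l p - p).totalDegree := by
    refine (totalDegree_mul _ _).trans ?_
    rw [totalDegree_C, zero_add]
    exact totalDegree_mul _ _
  have hB := totalDegree_mul p (shift K k q - q)
  have hAB := totalDegree_sub (C μ * (q * (shift K l p - p))) (p * (shift K k q - q))
  rw [hdeg, le_max_iff] at hAB
  rcases shift_sub_eq_zero_or_totalDegree_lt l p with h2 | h2 <;>
    rcases shift_sub_eq_zero_or_totalDegree_lt k q with h3 | h3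
  · simp [h2, h3] at hne
  · simp only [h2, mul_zero, totalDegree_zero] at hAB
    omega
  · simp only [h3, mul_zero, totalDegree_zero] at hAB
    omega
  · omega

/-! ### Integral roots in one variable -/

/-- The linear polynomial `u_e - c`. -/
def linFactor (K : Type*) [Field K] (e : E) (c : ℤ) : MvPolynomial E K := X e - C (c : K)

theorem shift_linFactor (k : E → ℤ) (e : E) (c : ℤ) :
    shift K k (linFactor K e c) = linFactor K e (c + k e) := by
  rw [linFactor, linFactor, map_sub, shift_X, shift_C]
  simp only [Int.cast_add, map_add]
  ring

theorem linFactor_dvd_shift_iff {k : E → ℤ} {e : E} {c : ℤ} {p : MvPolynomial E K} :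
    linFactor K e c ∣ shift K k p ↔ linFactor K e (c - k e) ∣ p := by
  rw [← map_dvd_iff (shift K k) (a := linFactor K e (c - k e)), shift_linFactor, sub_add_cancel]

theorem prime_linFactor (e : E) (c : ℤ) : Prime (linFactor K e c) := by
  have h : linFactor K e c = shift K (Finsupp.single e c) (X e) := by
    rw [shift_X, Finsupp.single_eq_same, linFactor]
  rw [h, MulEquiv.prime_iff]
  exact X_prime

theorem finite_linFactor_dvd [CharZero K] (e : E) {p : MvPolynomial E K} (hp : p ≠ 0) :
    {c : ℤ | linFactor K e c ∣ p}.Finite := by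
  classical
  -- Freezing all variables except `u_e` at a point where `p` does not vanish leaves a nonzero
  -- polynomial in one variable having every such `c` as a root.
  obtain ⟨v, hv⟩ : ∃ v, eval v p ≠ 0 := by
    by_contra! h
    exact hp (MvPolynomial.funext fun v => by rw [h v, map_zero])
  set P : Polynomial K :=
    aeval (Function.update (fun f => Polynomial.C (v f)) e Polynomial.X) p with hP
  have hPv : Polynomial.eval (v e) P = eval v p := by
    rw [hP, ← Polynomial.coe_aeval_eq_eval, ← AlgHom.comp_apply, comp_aeval, ← coe_aeval_eq_eval]
    change aeval _ p = aeval v p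
    congr 2
    funext f
    by_cases hf : f = e
    · subst hf; simp
    · simp [Function.update_of_ne hf]
  have hP0 : P ≠ 0 := by
    rintro h
    rw [h, Polynomial.eval_zero] at hPv
    exact hv hPv.symm
  refine Set.Finite.of_finite_image (f := fun c : ℤ => (c : K))
    ((P.roots.toFinset.finite_toSet).subset ?_) (Int.cast_injective.injOn)
  rintro _ ⟨c, ⟨q, hq⟩, rfl⟩
  rw [Finset.mem_coe, Multiset.mem_toFinset, Polynomial.mem_roots hP0, hP, hq]
  simp [linFactor]

/-- Reading the equation as one between sets of integral roots in `u_e`, every root of the left side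
yields another one displaced by `k e` or `l e`. These have the same sign, so the finite root set has
no extreme element and must be empty, whereas `X e ∣ p * q` provides a root. -/
theorem mul_shift_ne_of_dvd [CharZero K] {p q : MvPolynomial E K} (hp : p ≠ 0) (hq : q ≠ 0)
    {k l : E → ℤ} {e : E} (hkl : 0 < k e * l e) (hdvd : X e ∣ p * q) {μ : K} :
    p * shift K k q ≠ C μ * (q * shift K (-l) p) := by
  intro h
  have hμ : μ ≠ 0 := by
    rintro rfl
    rw [map_zero, zero_mul] at h
    exact mul_ne_zero hp ((map_ne_zero_iff _ (shift K k).injective).2 hq) h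
  set U : Set ℤ := {c | linFactor K e c ∣ p} ∪ {c | linFactor K e c ∣ shift K k q}
  have hfin : U.Finite := (finite_linFactor_dvd e hp).union
    (finite_linFactor_dvd e ((map_ne_zero_iff _ (shift K k).injective).2 hq))
  have hne : U.Nonempty := by
    have h0 : X e = linFactor K e 0 := by simp [linFactor]
    rw [h0] at hdvd
    rcases (prime_linFactor e 0).dvd_or_dvd hdvd with h1 | h1
    · exact ⟨0, Or.inl h1⟩
    · refine ⟨k e, Or.inr ?_⟩
      rw [Set.mem_ofPred_eq, linFactor_dvd_shift_iff, sub_self]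
      exact h1
  -- A root `c` of the right side is a root of `q`, which makes `c + k e` a root of `shift K k q`,
  -- or of `shift K (-l) p`, which makes `c + l e` a root of `p`.
  have hstep : ∀ c ∈ U, c + k e ∈ U ∨ c + l e ∈ U := by
    intro c hc
    have h1 : linFactor K e c ∣ C μ * (q * shift K (-l) p) := by
      rw [← h]
      exact hc.elim (fun h => h.mul_right _) (fun h => h.mul_left _)
    have hu : IsUnit (C μ : MvPolynomial E K) := hμ.isUnit.map C
    rcases (prime_linFactor e c).dvd_or_dvd (hu.dvd_mul_left.1 h1) with h2 | h2
    · left; right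
      rwa [Set.mem_ofPred_eq, linFactor_dvd_shift_iff, add_sub_cancel_right]
    · right; left
      rw [linFactor_dvd_shift_iff] at h2
      simpa using h2
  rcases pos_and_pos_or_neg_and_neg_of_mul_pos hkl with ⟨h1, h2⟩ | ⟨h1, h2⟩
  · obtain ⟨c, hc, hmax⟩ := Set.exists_max_image U id hfin hne
    rcases hstep c hc with h3 | h3 <;> have := hmax _ h3 <;> simp only [id] at this <;> omega
  · obtain ⟨c, hc, hmin⟩ := Set.exists_min_image U id hfin hne
    rcases hstep c hc with h3 | h3 <;> have := hmin _ h3 <;> simp only [id] at this <;> omega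

end

end TGW

namespace TGW

noncomputable section

/-! ### Homogeneous components of the construction -/

section Ring

variable {K R I : Type*} [Field K] [Ring R] [Algebra K R] {D : Datum K R I} {μ : I → I → K}

theorem Constr.base_apply (r : R) : Constr.base D μ r = Constr.gen D μ (.base r) := rfl

theorem Constr.gen_mem_comp (g : Gen R I) : Constr.gen D μ g ∈ Constr.comp D μ g.deg :=
  Submodule.subset_span ⟨[g], by simp, by simp⟩

theorem Constr.one_mem_comp : (1 : Constr D μ) ∈ Constr.comp D μ 0 :=
  Submodule.subset_span ⟨[], by simp, by simp⟩

theorem Constr.mul_mem_comp {d d' : I →₀ ℤ} {a b : Constr D μ} (ha : a ∈ Constr.comp D μ d)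
    (hb : b ∈ Constr.comp D μ d') : a * b ∈ Constr.comp D μ (d + d') := by
  have h : a * b ∈ Constr.comp D μ d * Constr.comp D μ d' := Submodule.mul_mem_mul ha hb
  rw [Constr.comp, Constr.comp, Submodule.span_mul_span] at h
  refine Submodule.span_mono ?_ h
  rintro _ ⟨_, ⟨l, rfl, rfl⟩, _, ⟨l', rfl, rfl⟩, rfl⟩
  exact ⟨l ++ l', by simp, by simp⟩

theorem mul_mem_closure_of_forall {A : Type*} [Ring A] {S T U : Set A}
    (h : ∀ s ∈ S, ∀ t ∈ T, s * t ∈ AddSubgroup.closure U) {a b : A}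
    (ha : a ∈ AddSubgroup.closure S) (hb : b ∈ AddSubgroup.closure T) :
    a * b ∈ AddSubgroup.closure U := by
  induction ha using AddSubgroup.closure_induction with
  | mem s hs =>
    induction hb using AddSubgroup.closure_induction with
    | mem t ht => exact h s hs t ht
    | zero => simp
    | add x y _ _ hx hy => rw [mul_add]; exact add_mem hx hy
    | neg x _ hx => rw [mul_neg]; exact neg_mem hx
  | zero => simp
  | add x y _ _ hx hy => rw [add_mul]; exact add_mem hx hy
  | neg x _ hx => rw [neg_mul]; exact neg_mem hx

theorem Constr.mem_closure_homogeneous (a : Constr D μ) :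
    a ∈ AddSubgroup.closure {b | ∃ d, b ∈ Constr.comp D μ d} := by
  obtain ⟨a, rfl⟩ := Constr.mk_surjective D μ a
  induction a using FreeAlgebra.induction with
  | grade0 c =>
    rw [AlgHom.commutes, Algebra.algebraMap_eq_smul_one]
    exact AddSubgroup.subset_closure ⟨0, Submodule.smul_mem _ _ Constr.one_mem_comp⟩
  | grade1 g => exact AddSubgroup.subset_closure ⟨_, Constr.gen_mem_comp g⟩
  | mul a b ha hb =>
    rw [map_mul]
    refine mul_mem_closure_of_forall ?_ ha hb
    rintro a ⟨d, ha⟩ b ⟨d', hb⟩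
    exact AddSubgroup.subset_closure ⟨_, Constr.mul_mem_comp ha hb⟩
  | add a b ha hb => rw [map_add]; exact add_mem ha hb

theorem Constr.X_mul_base (i : I) (r : R) : Constr.gen D μ (.X i) * Constr.base D μ r =
    Constr.base D μ (D.σ i r) * Constr.gen D μ (.X i) := by
  simpa [Constr.gen, Constr.base] using Constr.mk_rel (Rel.X_base (D := D) (μ := μ) i r)

theorem Constr.Y_mul_base (i : I) (r : R) : Constr.gen D μ (.Y i) * Constr.base D μ r =
    Constr.base D μ ((D.σ i).symm r) * Constr.gen D μ (.Y i) := by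
  simpa [Constr.gen, Constr.base] using Constr.mk_rel (Rel.Y_base (D := D) (μ := μ) i r)

theorem Constr.Y_mul_X (i : I) : Constr.gen D μ (.Y i) * Constr.gen D μ (.X i) =
    Constr.base D μ (D.t i) := by
  simpa [Constr.gen, Constr.base] using Constr.mk_rel (Rel.YX (D := D) (μ := μ) i)

theorem Constr.X_mul_Y (i : I) : Constr.gen D μ (.X i) * Constr.gen D μ (.Y i) =
    Constr.base D μ (D.σ i (D.t i)) := by
  simpa [Constr.gen, Constr.base] using Constr.mk_rel (Rel.XY (D := D) (μ := μ) i)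

theorem Constr.X_mul_Y_ne {i j : I} (h : i ≠ j) :
    Constr.gen D μ (.X i) * Constr.gen D μ (.Y j) =
      μ i j • (Constr.gen D μ (.Y j) * Constr.gen D μ (.X i)) := by
  simpa [Constr.gen] using Constr.mk_rel (Rel.XY_ne (D := D) (μ := μ) i j h)

variable (D μ) in
/-- The product of the generators `X i` along a list of indices. -/
def Constr.XWord (l : List I) : Constr D μ := (l.map fun i => Constr.gen D μ (.X i)).prod

variable (D μ) in
/-- The product of the generators `Y i` along a list of indices. -/
def Constr.YWord (l : List I) : Constr D μ := (l.map fun i => Constr.gen D μ (.Y i)).prod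

theorem Constr.XWord_nil : Constr.XWord D μ [] = 1 := by simp [Constr.XWord]

theorem Constr.YWord_nil : Constr.YWord D μ [] = 1 := by simp [Constr.YWord]

theorem Constr.XWord_cons (i : I) (l : List I) :
    Constr.XWord D μ (i :: l) = Constr.gen D μ (.X i) * Constr.XWord D μ l := by
  simp [Constr.XWord]

theorem Constr.YWord_cons (i : I) (l : List I) :
    Constr.YWord D μ (i :: l) = Constr.gen D μ (.Y i) * Constr.YWord D μ l := by
  simp [Constr.YWord]

theorem Constr.YWord_mul_base (l : List I) (r : R) :
    ∃ s, Constr.YWord D μ l * Constr.base D μ r = Constr.base D μ s * Constr.YWord D μ l := by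
  induction l with
  | nil => exact ⟨r, by simp [Constr.YWord_nil]⟩
  | cons i l ih =>
    obtain ⟨s, hs⟩ := ih
    exact ⟨(D.σ i).symm s, by
      rw [Constr.YWord_cons, mul_assoc, hs, ← mul_assoc, Constr.Y_mul_base, mul_assoc]⟩

/-- The degree of a product of generators `X i`. -/
def listDeg (l : List I) : I →₀ ℤ := (l.map fun i => Finsupp.single i 1).sum

theorem listDeg_nil : listDeg ([] : List I) = 0 := by simp [listDeg]

theorem listDeg_cons (i : I) (l : List I) :
    listDeg (i :: l) = Finsupp.single i 1 + listDeg l := by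
  simp [listDeg]

theorem listDeg_apply [DecidableEq I] (l : List I) (i : I) : listDeg l i = l.count i := by
  induction l with
  | nil => simp [listDeg_nil]
  | cons j l ih =>
    rw [listDeg_cons, Finsupp.add_apply, ih, List.count_cons, Finsupp.single_apply]
    by_cases h : j = i <;> simp [h, add_comm]

theorem listDeg_erase [DecidableEq I] {i : I} {l : List I} (h : i ∈ l) :
    listDeg (l.erase i) = listDeg l - Finsupp.single i 1 := by
  have : listDeg l = listDeg (i :: l.erase i) :=
    ((List.perm_cons_erase h).map _).sum_eq
  rw [this, listDeg_cons, add_sub_cancel_left]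

/-- Moving right, `X i` either passes every letter or meets its first `Y i` and merges with it into
an element of the base ring. -/
theorem Constr.X_mul_YWord [DecidableEq I] (i : I) (l : List I) :
    (∃ r, Constr.gen D μ (.X i) * Constr.YWord D μ l =
      Constr.base D μ r * (Constr.YWord D μ l * Constr.gen D μ (.X i))) ∨
    (i ∈ l ∧ ∃ r, Constr.gen D μ (.X i) * Constr.YWord D μ l =
      Constr.base D μ r * Constr.YWord D μ (l.erase i)) := by
  induction l with
  | nil => exact Or.inl ⟨1, by simp [Constr.YWord_nil]⟩
  | cons j l ih =>
    rw [Constr.YWord_cons, ← mul_assoc]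
    by_cases h : i = j
    · subst h
      exact Or.inr ⟨List.mem_cons_self, D.σ i (D.t i), by
        rw [Constr.X_mul_Y, List.erase_cons_head]⟩
    · rw [Constr.X_mul_Y_ne h, smul_mul_assoc, mul_assoc]
      rcases ih with ⟨r, hr⟩ | ⟨hi, r, hr⟩
      · refine Or.inl ⟨μ i j • (D.σ j).symm r, ?_⟩
        rw [hr, ← mul_assoc, Constr.Y_mul_base, map_smul, smul_mul_assoc]
        simp only [mul_assoc]
      · refine Or.inr ⟨List.mem_cons_of_mem _ hi, μ i j • (D.σ j).symm r, ?_⟩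
        rw [hr, ← mul_assoc, Constr.Y_mul_base, map_smul, smul_mul_assoc,
          List.erase_cons_tail (by simpa using Ne.symm h), Constr.YWord_cons, mul_assoc]

/-- Moving `Y j` right past `X i` uses the mixed relation backwards, so `μ i j` must be invertible.
-/
theorem Constr.Y_mul_XWord [DecidableEq I] (hμ : ∀ i j, i ≠ j → μ i j ≠ 0) {j : I} {l : List I}
    (hj : j ∈ l) : ∃ r, Constr.gen D μ (.Y j) * Constr.XWord D μ l =
      Constr.base D μ r * Constr.XWord D μ (l.erase j) := by
  induction l with
  | nil => simp at hj
  | cons i l ih =>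
    rw [Constr.XWord_cons, ← mul_assoc]
    by_cases h : i = j
    · subst h
      exact ⟨D.t i, by rw [Constr.Y_mul_X, List.erase_cons_head]⟩
    · obtain ⟨r, hr⟩ := ih ((List.mem_cons.1 hj).resolve_left (Ne.symm h))
      have hYX : Constr.gen D μ (.Y j) * Constr.gen D μ (.X i) =
          (μ i j)⁻¹ • (Constr.gen D μ (.X i) * Constr.gen D μ (.Y j)) := by
        rw [Constr.X_mul_Y_ne h, smul_smul, inv_mul_cancel₀ (hμ i j h), one_smul]
      refine ⟨(μ i j)⁻¹ • D.σ i r, ?_⟩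
      rw [hYX, smul_mul_assoc, mul_assoc, hr, ← mul_assoc, Constr.X_mul_base, map_smul,
        smul_mul_assoc, List.erase_cons_tail (by simpa using h), Constr.XWord_cons, mul_assoc]

/-- A product of generators can be reordered with the `Y i` to the left of the `X i`. -/
theorem Constr.exists_normal_form (l : List (Gen R I)) : ∃ (r : R) (a b : List I),
    (l.map (Constr.gen D μ)).prod =
      Constr.base D μ r * (Constr.YWord D μ a * Constr.XWord D μ b) ∧
    (l.map Gen.deg).sum = listDeg b - listDeg a := by
  classical
  induction l with
  | nil => exact ⟨1, [], [], by simp [Constr.YWord_nil, Constr.XWord_nil], by simp⟩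
  | cons g l ih =>
    obtain ⟨r, a, b, h, hdeg⟩ := ih
    simp only [List.map_cons, List.prod_cons, List.sum_cons, h, hdeg]
    cases g with
    | base s =>
      exact ⟨s * r, a, b, by rw [← Constr.base_apply, map_mul, mul_assoc], by simp [Gen.deg]⟩
    | Y i =>
      refine ⟨(D.σ i).symm r, i :: a, b, ?_, ?_⟩
      · rw [← mul_assoc, Constr.Y_mul_base, Constr.YWord_cons]
        simp only [mul_assoc]
      · rw [listDeg_cons, Gen.deg]; abel
    | X i =>
      rw [← mul_assoc, Constr.X_mul_base, mul_assoc, ← mul_assoc (Constr.gen D μ (.X i))]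
      rcases Constr.X_mul_YWord (D := D) (μ := μ) i a with ⟨s, hs⟩ | ⟨hi, s, hs⟩
      · refine ⟨D.σ i r * s, a, i :: b, ?_, ?_⟩
        · rw [hs, Constr.XWord_cons, map_mul]
          simp only [mul_assoc]
        · rw [listDeg_cons, Gen.deg]; abel
      · refine ⟨D.σ i r * s, a.erase i, b, ?_, ?_⟩
        · rw [hs, map_mul]
          simp only [mul_assoc]
        · rw [listDeg_erase hi, Gen.deg]; abel

/-- The last `Y j` is adjacent to the word in the `X i` and cancels against its `X j`; induction
removes the `Y`'s from the right. -/
theorem Constr.YWord_mul_XWord_of_perm (hμ : ∀ i j, i ≠ j → μ i j ≠ 0) {a b : List I}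
    (h : a.Perm b) : ∃ r, Constr.YWord D μ a * Constr.XWord D μ b = Constr.base D μ r := by
  classical
  induction a using List.reverseRecOn generalizing b with
  | nil =>
    rw [List.nil_perm.1 h]
    exact ⟨1, by simp [Constr.YWord_nil, Constr.XWord_nil]⟩
  | append_singleton a j ih =>
    have hj : j ∈ b := h.subset (by simp)
    obtain ⟨r, hr⟩ := Constr.Y_mul_XWord (D := D) hμ hj
    obtain ⟨s, hs⟩ := Constr.YWord_mul_base (D := D) (μ := μ) a r
    have hp : a.Perm (b.erase j) :=
      ((List.perm_append_singleton j a).symm.trans h |>.trans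
        (List.perm_cons_erase hj)).cons_inv
    obtain ⟨q, hq⟩ := ih hp
    refine ⟨s * q, ?_⟩
    have happ : Constr.YWord D μ (a ++ [j]) = Constr.YWord D μ a * Constr.gen D μ (.Y j) := by
      simp [Constr.YWord]
    rw [happ, mul_assoc, hr, ← mul_assoc, hs, mul_assoc, hq, map_mul]

/-- The component of degree zero is the image of the base ring. -/
theorem Constr.exists_base_of_mem_comp_zero (hμ : ∀ i j, i ≠ j → μ i j ≠ 0) {a : Constr D μ}
    (ha : a ∈ Constr.comp D μ 0) : ∃ r, a = Constr.base D μ r := by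
  classical
  unfold Constr.comp at ha
  induction ha using Submodule.span_induction with
  | mem a ha =>
    obtain ⟨l, hl, rfl⟩ := ha
    obtain ⟨r, a, b, h, hdeg⟩ := Constr.exists_normal_form (D := D) (μ := μ) l
    rw [hl, eq_comm, sub_eq_zero] at hdeg
    -- Degree zero means that each index occurs equally often among the `Y`'s and the `X`'s of the
    -- normal form.
    have hp : a.Perm b := List.perm_iff_count.2 fun i => by
      have := DFunLike.congr_fun hdeg i
      rw [listDeg_apply, listDeg_apply] at this
      exact_mod_cast this.symm
    obtain ⟨s, hs⟩ := Constr.YWord_mul_XWord_of_perm (D := D) hμ hp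
    exact ⟨r * s, by rw [h, hs, map_mul]⟩
  | zero => exact ⟨0, by simp⟩
  | add a b _ _ ha hb =>
    obtain ⟨r, rfl⟩ := ha
    obtain ⟨s, rfl⟩ := hb
    exact ⟨r + s, by simp⟩
  | smul c a _ ha =>
    obtain ⟨r, rfl⟩ := ha
    exact ⟨c • r, by simp⟩

/-! ### The radical and homomorphisms -/

/-- The largest graded ideal contained in the kernel of a homomorphism. -/
def gradedKer {B : Type*} [Ring B] (ψ : Constr D μ →+* B) : Ideal (Constr D μ) where
  carrier := AddSubgroup.closure {b | ψ b = 0 ∧ ∃ d, b ∈ Constr.comp D μ d}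
  add_mem' := add_mem
  zero_mem' := zero_mem _
  smul_mem' c a ha := by
    refine mul_mem_closure_of_forall ?_ (Constr.mem_closure_homogeneous c) ha
    rintro a ⟨d, ha⟩ b ⟨hb0, d', hb⟩
    exact AddSubgroup.subset_closure ⟨by rw [map_mul, hb0, mul_zero], _,
      Constr.mul_mem_comp ha hb⟩

theorem gradedKer_isTwoSided {B : Type*} [Ring B] (ψ : Constr D μ →+* B) :
    (gradedKer ψ).IsTwoSided where
  mul_mem_of_left {a} c ha := by
    refine mul_mem_closure_of_forall ?_ ha (Constr.mem_closure_homogeneous c)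
    rintro a ⟨ha0, d, ha⟩ b ⟨d', hb⟩
    exact AddSubgroup.subset_closure ⟨by rw [map_mul, ha0, zero_mul], _,
      Constr.mul_mem_comp ha hb⟩

theorem map_eq_zero_of_mem_gradedKer {B : Type*} [Ring B] {ψ : Constr D μ →+* B}
    {a : Constr D μ} (ha : a ∈ gradedKer ψ) : ψ a = 0 := by
  have hle : AddSubgroup.closure {b | ψ b = 0 ∧ ∃ d, b ∈ Constr.comp D μ d} ≤
      (RingHom.ker ψ).toAddSubgroup := (AddSubgroup.closure_le _).2 fun b hb => hb.1
  exact hle ha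

/-- If `ψ` is injective on the base ring, then homogeneous elements of its kernel vanish in the
twisted generalized Weyl algebra. -/
theorem mem_radical_of_map_eq_zero (hμ : ∀ i j, i ≠ j → μ i j ≠ 0) {B : Type*} [Ring B]
    {ψ : Constr D μ →+* B} (hψ : ∀ r, ψ (Constr.base D μ r) = 0 → r = 0) {d : I →₀ ℤ}
    {a : Constr D μ} (ha : a ∈ Constr.comp D μ d) (h0 : ψ a = 0) : a ∈ radical D μ := by
  have hmem : ∀ b, ψ b = 0 ∧ (∃ d, b ∈ Constr.comp D μ d) → b ∈ gradedKer ψ :=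
    fun b hb => AddSubgroup.subset_closure hb
  have hnull : IsNullIdeal (gradedKer ψ) :=
    { twoSided := gradedKer_isTwoSided ψ
      graded := fun a ha =>
        by
        have hsub : {b | ψ b = 0 ∧ ∃ d, b ∈ Constr.comp D μ d} ⊆
            {b | b ∈ gradedKer ψ ∧ ∃ d, b ∈ Constr.comp D μ d} :=
          fun b hb => ⟨hmem b hb, hb.2⟩
        exact AddSubgroup.closure_mono hsub ha
      zero_inter := fun a ha ha0 => by
        -- A degree-zero element comes from the base ring, where `ψ` has trivial kernel.
        obtain ⟨r, rfl⟩ := Constr.exists_base_of_mem_comp_zero hμ ha0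
        rw [hψ r (map_eq_zero_of_mem_gradedKer ha), map_zero] }
  exact Submodule.mem_sSup_of_mem hnull (hmem a ⟨h0, d, ha⟩)

/-- Each degree is a sum of degrees of generators, and left cancellability passes to products. -/
theorem exists_left_cancel_of_degree {B : Type*} [Ring B] {ψ : Constr D μ →+* B}
    (hX : ∀ i w, ψ (Constr.gen D μ (.X i)) * w = 0 → w = 0)
    (hY : ∀ i w, ψ (Constr.gen D μ (.Y i)) * w = 0 → w = 0) (d : I →₀ ℤ) :
    ∃ c ∈ Constr.comp D μ d, ∀ w, ψ c * w = 0 → w = 0 := by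
  have hadd {d d' : I →₀ ℤ} (h : ∃ c ∈ Constr.comp D μ d, ∀ w, ψ c * w = 0 → w = 0)
      (h' : ∃ c ∈ Constr.comp D μ d', ∀ w, ψ c * w = 0 → w = 0) :
      ∃ c ∈ Constr.comp D μ (d + d'), ∀ w, ψ c * w = 0 → w = 0 := by
    obtain ⟨c, hc, h⟩ := h
    obtain ⟨c', hc', h'⟩ := h'
    refine ⟨c * c', Constr.mul_mem_comp hc hc', fun w hw => h' w (h _ ?_)⟩
    rwa [map_mul, mul_assoc] at hw
  have h0 : ∃ c ∈ Constr.comp D μ 0, ∀ w, ψ c * w = 0 → w = 0 :=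
    ⟨1, Constr.one_mem_comp, fun w hw => by simpa using hw⟩
  induction d using Finsupp.induction_linear with
  | zero => exact h0
  | add d d' h h' => exact hadd h h'
  | single i n =>
    induction n using Int.induction_on with
    | zero => rwa [Finsupp.single_zero]
    | succ n ih =>
      rw [Finsupp.single_add]
      exact hadd ih ⟨_, Constr.gen_mem_comp (.X i), hX i⟩
    | pred n ih =>
      rw [sub_eq_add_neg, Finsupp.single_add, Finsupp.single_neg i 1]
      exact hadd ih ⟨_, Constr.gen_mem_comp (.Y i), hY i⟩

/-- A homogeneous `b` of degree `d` in a null ideal is brought to degree zero by a factor `c` of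
degree `-d`. Then `c b = 0`, and cancelling `ψ c` gives `ψ b = 0`. -/
theorem map_eq_zero_of_mem_radical {B : Type*} [Ring B] {ψ : Constr D μ →+* B}
    (hX : ∀ i w, ψ (Constr.gen D μ (.X i)) * w = 0 → w = 0)
    (hY : ∀ i w, ψ (Constr.gen D μ (.Y i)) * w = 0 → w = 0) {a : Constr D μ}
    (ha : a ∈ radical D μ) : ψ a = 0 := by
  have hle : radical D μ ≤ RingHom.ker ψ := sSup_le fun J hJ x hx => by
    refine (AddSubgroup.closure_le (K := (RingHom.ker ψ).toAddSubgroup)).2 ?_ (hJ.graded x hx)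
    rintro b ⟨hb, d, hd⟩
    obtain ⟨c, hc, h⟩ := exists_left_cancel_of_degree hX hY (-d)
    refine h _ ?_
    have hcb := Constr.mul_mem_comp hc hd
    rw [neg_add_cancel] at hcb
    rw [← map_mul, hJ.zero_inter _ (J.mul_mem_left c hb) hcb, map_zero]
  exact hle ha

/-! ### Construction of homomorphisms -/

/-- The homomorphism from the construction given by the images of the generators. -/
def Constr.lift {B : Type*} [Ring B] [Algebra K B] (f : Gen R I → B)
    (hf : ∀ ⦃a b⦄, Rel D μ a b → FreeAlgebra.lift K f a = FreeAlgebra.lift K f b) :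
    Constr D μ →ₐ[K] B :=
  RingQuot.liftAlgHom K ⟨FreeAlgebra.lift K f, hf⟩

theorem Constr.lift_gen {B : Type*} [Ring B] [Algebra K B] (f : Gen R I → B)
    (hf : ∀ ⦃a b⦄, Rel D μ a b → FreeAlgebra.lift K f a = FreeAlgebra.lift K f b) (g : Gen R I) :
    Constr.lift f hf (Constr.gen D μ g) = f g :=
  (RingQuot.liftAlgHom_mkAlgHom_apply K _ (s := Rel D μ) hf (fgen K g)).trans
    (FreeAlgebra.lift_ι_apply _ _)

theorem Alg.mk_eq_zero {a : Constr D μ} : Alg.mk D μ a = 0 ↔ a ∈ radical D μ :=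
  Ideal.Quotient.eq_zero_iff_mem

/-- The homomorphism induced on the twisted generalized Weyl algebra. -/
def Alg.lift {B : Type*} [Ring B] [Algebra K B] (ψ : Constr D μ →ₐ[K] B)
    (hψ : ∀ a ∈ radical D μ, ψ a = 0) : Alg D μ →ₐ[K] B :=
  Ideal.Quotient.liftₐ (radical D μ) ψ hψ

theorem Constr.algHom_ext {B : Type*} [Ring B] [Algebra K B] {f g : Constr D μ →ₐ[K] B}
    (h : ∀ x, f (Constr.gen D μ x) = g (Constr.gen D μ x)) : f = g := by
  refine AlgHom.ext fun a => ?_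
  obtain ⟨a, rfl⟩ := Constr.mk_surjective D μ a
  exact DFunLike.congr_fun (FreeAlgebra.hom_ext (f := f.comp (Constr.mk D μ))
    (g := g.comp (Constr.mk D μ)) (funext h)) a

theorem Alg.mul_mem_comp {d d' : I →₀ ℤ} {a b : Alg D μ} (ha : a ∈ Alg.comp D μ d)
    (hb : b ∈ Alg.comp D μ d') : a * b ∈ Alg.comp D μ (d + d') := by
  obtain ⟨a, ha, rfl⟩ := ha
  obtain ⟨b, hb, rfl⟩ := hb
  exact ⟨a * b, Constr.mul_mem_comp ha hb, map_mul (Alg.mk D μ) a b⟩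

theorem Alg.mk_gen_mem_comp (g : Gen R I) : Alg.mk D μ (Constr.gen D μ g) ∈ Alg.comp D μ g.deg :=
  ⟨_, Constr.gen_mem_comp g, rfl⟩

theorem map_mem_comp {D' : Datum K R I} {μ' : I → I → K} {k : Constr D μ →ₐ[K] Alg D' μ'}
    (h : ∀ g, k (Constr.gen D μ g) ∈ Alg.comp D' μ' g.deg) {d : I →₀ ℤ} {a : Constr D μ}
    (ha : a ∈ Constr.comp D μ d) : k a ∈ Alg.comp D' μ' d := by
  unfold Constr.comp at ha
  induction ha using Submodule.span_induction with
  | mem a ha =>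
    obtain ⟨l, rfl, rfl⟩ := ha
    induction l with
    | nil => exact ⟨1, Constr.one_mem_comp, by simp⟩
    | cons g l ih =>
      simp only [List.map_cons, List.prod_cons, List.sum_cons, map_mul]
      exact Alg.mul_mem_comp (h g) ih
  | zero => simp
  | add a b _ _ ha hb => rw [map_add]; exact add_mem ha hb
  | smul c a _ ha => rw [map_smul]; exact Submodule.smul_mem _ c ha

end Ring

section Involution

variable {K R I : Type*} [Field K] [CommRing R] [Algebra K R] {D : Datum K R I} {μ : I → I → K}

/-- Both sides are additive, reverse products and fix scalars, so agreement on generators suffices.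
-/
theorem map_inv_of_gen (hμ : ∀ i j, i ≠ j → μ i j = μ j i) {B : Type*} [Ring B] [Algebra K B]
    (k : Alg D μ →ₐ[K] B) (S : RingInvolution R B)
    (hS : ∀ c, S.inv (algebraMap K B c) = algebraMap K B c)
    (hk : ∀ g : Gen R I, k (Alg.mk D μ (Constr.gen D μ g.swap)) =
      S.inv (k (Alg.mk D μ (Constr.gen D μ g)))) (a : Alg D μ) :
    k (Alg.inv D μ hμ a) = S.inv (k a) := by
  obtain ⟨a, rfl⟩ := Alg.mk_surjective D μ a
  obtain ⟨a, rfl⟩ := Constr.mk_surjective D μ a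
  rw [Alg.inv_mk]
  induction a using FreeAlgebra.induction with
  | grade0 c =>
    rw [AlgHom.commutes, Constr.inv_algebraMap, AlgHom.commutes, AlgHom.commutes, hS]
  | grade1 g =>
    change k (Alg.mk D μ (Constr.inv D μ hμ (Constr.gen D μ g))) =
      S.inv (k (Alg.mk D μ (Constr.gen D μ g)))
    rw [Constr.inv_gen, hk]
  | mul a b ha hb => simp only [map_mul, Constr.inv_mul, S.inv_mul, ha, hb]
  | add a b ha hb => simp only [map_add, ha, hb]

end Involution

end

end TGW

/-! ### Multiquivers and their incidence matrices -/

namespace Multiquiver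

noncomputable section

variable {V E : Type*}

theorem mult_some_self (v : V) (n : ℕ+) : mult v (some (v, n)) = n := by simp [mult]

theorem mult_nonneg (v : V) (o : Option (V × ℕ+)) : 0 ≤ mult v o := by
  rcases o with _ | ⟨w, n⟩
  · simp [mult]
  · simp only [mult]; split_ifs <;> simp

theorem γ_apply (Γ : Multiquiver V E) (v : V) (e : E) :
    Γ.γ v e = mult v (Γ.t e) - mult v (Γ.s e) := rfl

/-- Without loops at most one of the two multiplicities in `γ` is nonzero, so no cancellation can
hide an end of an edge. -/
theorem γ_eq_coe_iff (Γ : Multiquiver V E) {v : V} {e : E} {n : ℕ+} :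
    Γ.γ v e = (n : ℤ) ↔ Γ.t e = some (v, n) := by
  have hn : (0 : ℤ) < n := by exact_mod_cast n.pos
  have hs : ∀ m, Γ.t e = some (v, m) → mult v (Γ.s e) = 0 := by
    intro m hm
    by_contra h
    obtain ⟨m', hm'⟩ := mult_ne_zero h
    exact Γ.no_loops e _ _ _ _ hm' hm rfl
  rw [γ_apply]
  constructor
  · intro h
    have h1 := mult_nonneg v (Γ.s e)
    obtain ⟨m, hm⟩ := mult_ne_zero (v := v) (o := Γ.t e) (by omega)
    rw [hs m hm, hm, mult_some_self, sub_zero] at h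
    rw [hm, PNat.eq (Int.ofNat_inj.1 h)]
  · intro h
    rw [hs n h, h, mult_some_self, sub_zero]

theorem γ_eq_neg_coe_iff (Γ : Multiquiver V E) {v : V} {e : E} {n : ℕ+} :
    Γ.γ v e = -(n : ℤ) ↔ Γ.s e = some (v, n) := by
  have hn : (0 : ℤ) < n := by exact_mod_cast n.pos
  have hs : ∀ m, Γ.s e = some (v, m) → mult v (Γ.t e) = 0 := by
    intro m hm
    by_contra h
    obtain ⟨m', hm'⟩ := mult_ne_zero h
    exact Γ.no_loops e _ _ _ _ hm hm' rfl
  rw [γ_apply]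
  constructor
  · intro h
    have h1 := mult_nonneg v (Γ.t e)
    obtain ⟨m, hm⟩ := mult_ne_zero (v := v) (o := Γ.s e) (by omega)
    rw [hs m hm, hm, mult_some_self, zero_sub, neg_inj] at h
    rw [hm, PNat.eq (Int.ofNat_inj.1 h)]
  · intro h
    rw [hs n h, h, mult_some_self, zero_sub]

theorem exists_eq_coe_pnat {n : ℤ} (h : 0 < n) : ∃ m : ℕ+, n = (m : ℤ) :=
  ⟨⟨n.toNat, by omega⟩, by simp [h.le]⟩

theorem ext_of_γ {Γ Γ' : Multiquiver V E} (h : ∀ v, Γ.γ v = Γ'.γ v) : Γ = Γ' := by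
  have ht : Γ.t = Γ'.t := by
    funext e
    refine Option.ext fun p => ?_
    rw [← γ_eq_coe_iff (v := p.1) (n := p.2), ← γ_eq_coe_iff (v := p.1) (n := p.2), h]
  have hs : Γ.s = Γ'.s := by
    funext e
    refine Option.ext fun p => ?_
    rw [← γ_eq_neg_coe_iff (v := p.1) (n := p.2), ← γ_eq_neg_coe_iff (v := p.1) (n := p.2), h]
  cases Γ; cases Γ'
  simp_all

/-- Entries of the same strict sign would give one edge two different targets or two different
sources. -/
theorem γ_mul_γ_nonpos (Γ : Multiquiver V E) {v w : V} (h : v ≠ w) (e : E) :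
    Γ.γ v e * Γ.γ w e ≤ 0 := by
  by_contra! hpos
  rcases pos_and_pos_or_neg_and_neg_of_mul_pos hpos with ⟨h1, h2⟩ | ⟨h1, h2⟩
  · obtain ⟨m, hm⟩ := exists_eq_coe_pnat h1
    obtain ⟨n, hn⟩ := exists_eq_coe_pnat h2
    rw [γ_eq_coe_iff] at hm hn
    rw [hm] at hn
    exact h (congrArg Prod.fst (Option.some_inj.1 hn))
  · obtain ⟨m, hm⟩ := exists_eq_coe_pnat (neg_pos.2 h1)
    obtain ⟨n, hn⟩ := exists_eq_coe_pnat (neg_pos.2 h2)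
    rw [neg_eq_iff_eq_neg, γ_eq_neg_coe_iff] at hm hn
    rw [hm] at hn
    exact h (congrArg Prod.fst (Option.some_inj.1 hn))

open Classical in
/-- An end of the edge `e` in the multiquiver with prescribed columns `k`, for the sign `ε`. -/
def endOfColumns (k : V → E →₀ ℤ) (ε : ℤ) (e : E) : Option (V × ℕ+) :=
  if h : ∃ p : V × ℕ+, k p.1 e = ε * p.2 then some h.choose else none

theorem endOfColumns_eq_some_iff {k : V → E →₀ ℤ}
    (hk : ∀ v w, v ≠ w → ∀ e, k v e * k w e ≤ 0) {ε : ℤ} (hε : ε * ε = 1) {e : E} {v : V}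
    {n : ℕ+} : endOfColumns k ε e = some (v, n) ↔ k v e = ε * n := by
  unfold endOfColumns
  constructor
  · intro h
    split_ifs at h with h'
    have := h'.choose_spec
    rwa [Option.some_inj.1 h] at this
  · intro h
    have h' : ∃ p : V × ℕ+, k p.1 e = ε * p.2 := ⟨(v, n), h⟩
    rw [dif_pos h', Option.some_inj]
    have hc := h'.choose_spec
    generalize h'.choose = p at hc
    obtain ⟨w, m⟩ := p
    dsimp only at hc
    have hmn : 0 < (m : ℤ) * n := by exact_mod_cast Nat.mul_pos m.pos n.pos
    -- Two vertices with entries `ε m` and `ε n` would have product `m n > 0`, contrary to `hk`; so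
    -- the chosen pair is the only one.
    have hvw : w = v := by
      by_contra hne
      have := hk w v hne e
      rw [hc, h, mul_mul_mul_comm, hε, one_mul] at this
      exact absurd hmn (not_lt.2 this)
    subst hvw
    have hε0 : ε ≠ 0 := by rintro rfl; simp at hε
    rw [hc] at h
    have := mul_left_cancel₀ hε0 h
    rw [Prod.mk.injEq]
    exact ⟨rfl, PNat.eq (Int.ofNat_inj.1 this)⟩

/-- The multiquiver with prescribed columns of the incidence matrix. -/
def ofColumns (k : V → E →₀ ℤ) (hk : ∀ v w, v ≠ w → ∀ e, k v e * k w e ≤ 0) :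
    Multiquiver V E where
  s := endOfColumns k (-1)
  t := endOfColumns k 1
  no_loops e u m v n hs ht := by
    rw [endOfColumns_eq_some_iff hk (by norm_num)] at hs ht
    rintro rfl
    have hm := m.pos
    have hn := n.pos
    omega
  finite_s v := by
    refine (k v).support.finite_toSet.subset ?_
    rintro e ⟨n, hn⟩
    rw [endOfColumns_eq_some_iff hk (by norm_num)] at hn
    have := n.pos
    rw [Finset.mem_coe, Finsupp.mem_support_iff]
    omega
  finite_t v := by
    refine (k v).support.finite_toSet.subset ?_
    rintro e ⟨n, hn⟩
    rw [endOfColumns_eq_some_iff hk (by norm_num)] at hn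
    have := n.pos
    rw [Finset.mem_coe, Finsupp.mem_support_iff]
    omega

theorem γ_ofColumns (k : V → E →₀ ℤ) (hk : ∀ v w, v ≠ w → ∀ e, k v e * k w e ≤ 0) (v : V) :
    (ofColumns k hk).γ v = k v := by
  ext e
  have hpos (n : ℕ+) : (ofColumns k hk).γ v e = n ↔ k v e = n := by
    rw [γ_eq_coe_iff]
    exact (endOfColumns_eq_some_iff hk (by norm_num)).trans (by rw [one_mul])
  have hneg (n : ℕ+) : (ofColumns k hk).γ v e = -n ↔ k v e = -n := by
    rw [γ_eq_neg_coe_iff]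
    exact (endOfColumns_eq_some_iff hk (by norm_num)).trans (by rw [neg_one_mul])
  rcases lt_trichotomy (k v e) 0 with h | h | h
  · obtain ⟨n, hn⟩ := exists_eq_coe_pnat (neg_pos.2 h)
    rw [neg_eq_iff_eq_neg] at hn
    rw [(hneg n).2 hn, hn]
  · rw [h]
    by_contra h0
    rcases lt_or_gt_of_ne h0 with h1 | h1
    · obtain ⟨n, hn⟩ := exists_eq_coe_pnat (neg_pos.2 h1)
      rw [neg_eq_iff_eq_neg] at hn
      have := n.pos
      have := (hneg n).1 hn
      omega
    · obtain ⟨n, hn⟩ := exists_eq_coe_pnat h1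
      have := n.pos
      have := (hpos n).1 hn
      omega
  · obtain ⟨n, hn⟩ := exists_eq_coe_pnat h
    rw [(hpos n).2 hn, hn]

end

end Multiquiver

namespace TGW

noncomputable section

open MvPolynomial Multiquiver

/-! ### Relations in a twisted generalized Weyl algebra -/

section Ring

variable {K R I : Type*} [Field K] [Ring R] [Algebra K R] {D : Datum K R I} {μ : I → I → K}

theorem Alg.X_mul_base (i : I) (r : R) :
    Alg.X D μ i * Alg.base D μ r = Alg.base D μ (D.σ i r) * Alg.X D μ i := by
  have h := congrArg (Alg.mk D μ) (Constr.X_mul_base i r)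
  simp only [map_mul] at h
  exact h

theorem Alg.Y_mul_base (i : I) (r : R) :
    Alg.Y D μ i * Alg.base D μ r = Alg.base D μ ((D.σ i).symm r) * Alg.Y D μ i := by
  have h := congrArg (Alg.mk D μ) (Constr.Y_mul_base i r)
  simp only [map_mul] at h
  exact h

theorem Alg.Y_mul_X (i : I) : Alg.Y D μ i * Alg.X D μ i = Alg.base D μ (D.t i) := by
  have h := congrArg (Alg.mk D μ) (Constr.Y_mul_X i)
  simp only [map_mul] at h
  exact h

theorem Alg.X_mul_Y (i : I) : Alg.X D μ i * Alg.Y D μ i = Alg.base D μ (D.σ i (D.t i)) := by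
  have h := congrArg (Alg.mk D μ) (Constr.X_mul_Y i)
  simp only [map_mul] at h
  exact h

theorem Alg.X_mul_Y_ne {i j : I} (h : i ≠ j) :
    Alg.X D μ i * Alg.Y D μ j = μ i j • (Alg.Y D μ j * Alg.X D μ i) := by
  have h' := congrArg (Alg.mk D μ) (Constr.X_mul_Y_ne h)
  simp only [map_mul, map_smul] at h'
  exact h'

end Ring

variable {K V E : Type*} [Field K]

/-- The total weight `∑ d_v γ(v)` of a degree `d`. -/
def weight (Γ : Multiquiver V E) (d : V →₀ ℤ) : E → ℤ := d.sum fun v n => n • (Γ.γ v : E → ℤ)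

theorem weight_add (Γ : Multiquiver V E) (d d' : V →₀ ℤ) :
    weight Γ (d + d') = weight Γ d + weight Γ d' :=
  Finsupp.sum_add_index' (fun _ => zero_smul _ _) fun _ _ _ => add_smul _ _ _

theorem weight_single (Γ : Multiquiver V E) (v : V) (n : ℤ) :
    weight Γ (Finsupp.single v n) = n • (Γ.γ v : E → ℤ) :=
  Finsupp.sum_single_index (zero_smul _ _)

theorem weight_zero (Γ : Multiquiver V E) : weight Γ 0 = 0 := Finsupp.sum_zero_index

/-- The grading determines how an element moves past `R_E`; uniqueness of `Γ` applies this to the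
image of `X_i`, of which only the degree is known. -/
theorem Constr.mul_base_of_mem_comp {Γ : Multiquiver V E} {μ : V → V → K} {d : V →₀ ℤ}
    {a : Constr (Γ.datum K) μ} (ha : a ∈ Constr.comp (Γ.datum K) μ d) (r : MvPolynomial E K) :
    a * Constr.base _ μ r = Constr.base _ μ (shift K (weight Γ d) r) * a := by
  unfold Constr.comp at ha
  induction ha using Submodule.span_induction generalizing r with
  | mem a ha =>
    obtain ⟨l, rfl, rfl⟩ := ha
    induction l generalizing r with
    | nil => simp [weight_zero, shift_zero]
    | cons g l ih =>
      simp only [List.map_cons, List.prod_cons, List.sum_cons]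
      rw [mul_assoc, ih, ← mul_assoc, weight_add, ← shift_shift, ← mul_assoc]
      congr 1
      cases g with
      | base s =>
        rw [← Constr.base_apply, ← map_mul, ← map_mul, mul_comm, Gen.deg, weight_zero, shift_zero]
      | X v =>
        rw [Constr.X_mul_base, Gen.deg, weight_single, one_smul]
        rfl
      | Y v =>
        rw [Constr.Y_mul_base, Gen.deg, ← Finsupp.single_neg, weight_single, neg_smul, one_smul,
          ← shift_symm]
        rfl
  | zero => simp
  | add a b _ _ ha hb => rw [add_mul, mul_add, ha, hb]
  | smul c a _ ha => rw [smul_mul_assoc, mul_smul_comm, ha]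

theorem Alg.mul_base_of_mem_comp {Γ : Multiquiver V E} {μ : V → V → K} {d : V →₀ ℤ}
    {a : Alg (Γ.datum K) μ} (ha : a ∈ Alg.comp (Γ.datum K) μ d) (r : MvPolynomial E K) :
    a * Alg.base _ μ r = Alg.base _ μ (shift K (weight Γ d) r) * a := by
  obtain ⟨a, ha, rfl⟩ := ha
  have h := congrArg (Alg.mk _ μ) (Constr.mul_base_of_mem_comp ha r)
  simp only [map_mul] at h
  exact h

/-! ### The canonical representation -/

/-- The images of the generators under the canonical representation. -/
def repGen (K : Type*) [Field K] (Γ : Multiquiver V E) : Gen (MvPolynomial E K) V → Weyl K E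
  | .base r => Weyl.base K E r
  | .X v => Weyl.z K (Γ.γ v)
  | .Y v => Weyl.z K (-Γ.γ v)

theorem repGen_rel (Γ : Multiquiver V E) ⦃a b : FreeAlgebra K (Gen (MvPolynomial E K) V)⦄
    (h : Rel (Γ.datum K) (fun _ _ => 1) a b) :
    FreeAlgebra.lift K (repGen K Γ) a = FreeAlgebra.lift K (repGen K Γ) b := by
  induction h <;> simp only [map_add, map_mul, map_smul, FreeAlgebra.lift_ι_apply, repGen,
    AlgHom.commutes]
  case X_base v r => exact Weyl.z_mul_base _ r
  case Y_base v r =>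
    refine (Weyl.z_mul_base _ r).trans ?_
    rw [Finsupp.coe_neg, ← shift_symm]
    rfl
  case YX v => exact Weyl.z_neg_mul_z _
  case XY v => exact Weyl.z_mul_z_neg _
  case XY_ne v w h =>
    rw [one_smul]
    -- Entries of `γ(v)` and `γ(w)` never share a strict sign, so those of `γ(v)` and `-γ(w)` never
    -- have opposite ones.
    refine (Weyl.z_commute fun e => ?_).eq
    rw [Finsupp.neg_apply, mul_neg, neg_nonneg]
    exact Γ.γ_mul_γ_nonpos h e

/-- The canonical representation, before passing to the quotient. -/
def constrRep (K : Type*) [Field K] (Γ : Multiquiver V E) :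
    Constr (Γ.datum K) (fun _ _ => 1) →ₐ[K] Weyl K E :=
  Constr.lift (repGen K Γ) (repGen_rel Γ)

theorem constrRep_gen (Γ : Multiquiver V E) (g : Gen (MvPolynomial E K) V) :
    constrRep K Γ (Constr.gen _ _ g) = repGen K Γ g := Constr.lift_gen _ _ _

theorem constrRep_base (Γ : Multiquiver V E) (r : MvPolynomial E K) :
    constrRep K Γ (Constr.base _ _ r) = Weyl.base K E r := constrRep_gen Γ (.base r)

/-! ### The canonical representation on the quotient and its injectivity on homogeneous elements. -/

section CharZero

variable [CharZero K]

/-- The canonical representation `φ_Γ`. -/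
def rep (K : Type*) [Field K] [CharZero K] (Γ : Multiquiver V E) : Γ.algebra K →ₐ[K] Weyl K E :=
  Alg.lift (constrRep K Γ) fun a ha => by
    refine map_eq_zero_of_mem_radical (ψ := (constrRep K Γ).toRingHom) (fun i w hw => ?_)
      (fun i w hw => ?_) ha
    · exact Weyl.eq_zero_of_z_mul_eq_zero ((congrArg (· * w) (constrRep_gen Γ (.X i))).symm.trans hw)
    · exact Weyl.eq_zero_of_z_mul_eq_zero ((congrArg (· * w) (constrRep_gen Γ (.Y i))).symm.trans hw)

theorem rep_mk (Γ : Multiquiver V E) (a : Constr (Γ.datum K) (fun _ _ => 1)) :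
    rep K Γ (Alg.mk _ _ a) = constrRep K Γ a := rfl

theorem rep_base (Γ : Multiquiver V E) (r : MvPolynomial E K) :
    rep K Γ (Alg.base _ _ r) = Weyl.base K E r := constrRep_base Γ r

theorem rep_X (Γ : Multiquiver V E) (v : V) : rep K Γ (Alg.X _ _ v) = Weyl.z K (Γ.γ v) :=
  constrRep_gen Γ (.X v)

theorem rep_Y (Γ : Multiquiver V E) (v : V) : rep K Γ (Alg.Y _ _ v) = Weyl.z K (-Γ.γ v) :=
  constrRep_gen Γ (.Y v)

theorem isCanonicalRep_rep (Γ : Multiquiver V E) :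
    Γ.IsCanonicalRep (rep K Γ : Γ.algebra K →+* Weyl K E) where
  isMap := by
    refine ⟨RingHom.ext (rep_base Γ), ?_⟩
    refine map_inv_of_gen _ (rep K Γ) (Weyl.ringInvolution K E) Weyl.inv_algebraMap fun g => ?_
    rw [rep_mk, rep_mk, constrRep_gen, constrRep_gen]
    cases g with
    | base r => exact (Weyl.inv_base r).symm
    | X v => exact (Weyl.inv_z _).symm
    | Y v => exact ((Weyl.inv_z _).trans (by rw [neg_neg]; rfl)).symm
  map_X := rep_X Γ
  map_Y := rep_Y Γ

/-- A homogeneous kernel element of the construction already lies in the radical, because the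
representation is injective on `R_E`. -/
theorem eq_zero_of_rep_eq_zero {Γ : Multiquiver V E} {d : V →₀ ℤ} {a : Γ.algebra K}
    (ha : a ∈ Alg.comp (Γ.datum K) (fun _ _ => 1) d) (h : rep K Γ a = 0) : a = 0 := by
  obtain ⟨a, ha, rfl⟩ := ha
  refine Alg.mk_eq_zero.2 (mem_radical_of_map_eq_zero (fun _ _ _ => one_ne_zero)
    (ψ := (constrRep K Γ).toRingHom) (fun r hr => ?_) ha h)
  refine Weyl.base_injective ((constrRep_base Γ r).symm.trans (hr.trans (map_zero _).symm))

end CharZero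

end

end TGW

namespace TGW

noncomputable section

open MvPolynomial Multiquiver

variable {K V E : Type*} [Field K]

/-! ### Structure of a homomorphism to the Weyl algebra -/

section Hom

variable {D : Datum K (MvPolynomial E K) V} {μ : V → V → K} {hμ : ∀ i j, i ≠ j → μ i j = μ j i}
  {φ : Alg D μ →+* Weyl K E}

theorem map_base_of_isMap (hφ : (Alg.ringInvolution D μ hμ).IsMap (Weyl.ringInvolution K E) φ)
    (r : MvPolynomial E K) : φ (Alg.base D μ r) = Weyl.base K E r :=
  RingHom.congr_fun hφ.1 r

theorem map_Y_of_isMap (hφ : (Alg.ringInvolution D μ hμ).IsMap (Weyl.ringInvolution K E) φ)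
    (i : V) : φ (Alg.Y D μ i) = Weyl.inv K E (φ (Alg.X D μ i)) := by
  rw [← Alg.inv_X D μ hμ]
  exact hφ.2 _

/-- `φ` is only a ring homomorphism, but the scalars are images of constants of `R_E`, which it
respects. -/
theorem map_smul_of_isMap (hφ : (Alg.ringInvolution D μ hμ).IsMap (Weyl.ringInvolution K E) φ)
    (c : K) (a : Alg D μ) : φ (c • a) = c • φ a := by
  rw [Algebra.smul_def, map_mul, Algebra.smul_def, ← (Alg.base D μ).commutes,
    map_base_of_isMap hφ, (Weyl.base K E).commutes]

theorem map_X_mul_base (hφ : (Alg.ringInvolution D μ hμ).IsMap (Weyl.ringInvolution K E) φ)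
    (i : V) (r : MvPolynomial E K) :
    φ (Alg.X D μ i) * Weyl.base K E r = Weyl.base K E (D.σ i r) * φ (Alg.X D μ i) := by
  rw [← map_base_of_isMap hφ, ← map_base_of_isMap hφ, ← map_mul, ← map_mul, Alg.X_mul_base]

/-- `φ(Y_i) φ(X_i)` is the image of `t_i ≠ 0` under the injective map from `R_E`. -/
theorem map_X_ne_zero (hφ : (Alg.ringInvolution D μ hμ).IsMap (Weyl.ringInvolution K E) φ)
    (i : V) : φ (Alg.X D μ i) ≠ 0 := fun h => by
  have h1 := congrArg φ (Alg.Y_mul_X (D := D) (μ := μ) i)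
  rw [map_mul, h, mul_zero, map_base_of_isMap hφ] at h1
  exact D.t_ne_zero i (Weyl.base_injective (h1.symm.trans (map_zero _).symm))

theorem isConsistent_of_isMap
    (hφ : (Alg.ringInvolution D μ hμ).IsMap (Weyl.ringInvolution K E) φ) : IsConsistent D μ :=
  fun r s h => Weyl.base_injective <| by
    rw [← map_base_of_isMap hφ, ← map_base_of_isMap hφ, h]

/-- The monomials `r_i z^{k_i}` to which the `X i` are mapped. -/
structure MonomialImage (φ : Alg D μ →+* Weyl K E) (k : V → E →₀ ℤ)
    (r : V → MvPolynomial E K) : Prop where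
  σ_eq : ∀ i, D.σ i = shift K (k i)
  ne_zero : ∀ i, r i ≠ 0
  map_X : ∀ i, φ (Alg.X D μ i) = Weyl.base K E (r i) * Weyl.z K (k i)
  map_Y : ∀ i, φ (Alg.Y D μ i) = Weyl.z K (-k i) * Weyl.base K E (r i)

variable {k : V → E →₀ ℤ} {r : V → MvPolynomial E K}

theorem MonomialImage.coeff_ne_zero (h : MonomialImage φ k r) (i : V) :
    r i * Weyl.zCoeff K (k i) ≠ 0 := mul_ne_zero (h.ne_zero i) (Weyl.zCoeff_ne_zero _)

theorem MonomialImage.coeff_ne_zero' (h : MonomialImage φ k r) (i : V) :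
    Weyl.zCoeff K (-k i) * shift K (-k i) (r i) ≠ 0 :=
  mul_ne_zero (Weyl.zCoeff_ne_zero _)
    ((map_ne_zero_iff _ (shift K (-k i)).injective).2 (h.ne_zero i))

theorem Alg.base_mem_comp_zero (s : MvPolynomial E K) : Alg.base D μ s ∈ Alg.comp D μ 0 :=
  Alg.mk_gen_mem_comp (.base s)

theorem MonomialImage.t_eq (h : MonomialImage φ k r)
    (hφ : (Alg.ringInvolution D μ hμ).IsMap (Weyl.ringInvolution K E) φ) (i : V) :
    D.t i = shift K (-k i) (r i * r i) * ∏ e ∈ (k i).support, uFactor K e (k i e) := by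
  have h1 := congrArg φ (Alg.Y_mul_X (D := D) (μ := μ) i)
  rw [map_mul, h.map_X, h.map_Y, map_base_of_isMap hφ] at h1
  refine Weyl.base_injective (h1.symm.trans ?_)
  rw [map_mul, ← Weyl.z_neg_mul_z, ← mul_assoc (Weyl.base K E _), ← Weyl.z_mul_base, map_mul]
  simp only [mul_assoc]

theorem MonomialImage.map_X_mul_map_Y (h : MonomialImage φ k r)
    (hφ : (Alg.ringInvolution D μ hμ).IsMap (Weyl.ringInvolution K E) φ) {i j : V} (hij : i ≠ j) :
    (Weyl.base K E (r i) * Weyl.z K (k i)) * (Weyl.z K (-k j) * Weyl.base K E (r j)) =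
      μ i j • ((Weyl.z K (-k j) * Weyl.base K E (r j)) *
        (Weyl.base K E (r i) * Weyl.z K (k i))) := by
  have h1 := congrArg φ (Alg.X_mul_Y_ne (D := D) (μ := μ) hij)
  rwa [map_mul, map_smul_of_isMap hφ, map_mul, h.map_X, h.map_Y] at h1

/-- The images of `X_i` and `Y_j` act as `p τ_{k_i}` and `q τ_{-k_j}`; this is the mixed relation
evaluated at `1`, with `p` and `q` kept intact for the degree and root arguments. -/
theorem MonomialImage.polynomial_relation (h : MonomialImage φ k r)
    (hφ : (Alg.ringInvolution D μ hμ).IsMap (Weyl.ringInvolution K E) φ) {i j : V} (hij : i ≠ j) :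
    (r i * Weyl.zCoeff K (k i)) * shift K (k i) (Weyl.zCoeff K (-k j) * shift K (-k j) (r j)) =
      C (μ i j) * ((Weyl.zCoeff K (-k j) * shift K (-k j) (r j)) *
        shift K (-k j) (r i * Weyl.zCoeff K (k i))) := by
  have h1 := congrArg (fun w => Weyl.act K E w 1) (h.map_X_mul_map_Y hφ hij)
  simp only [map_mul, map_smul, Module.End.mul_apply, Weyl.act_base, Weyl.act_z,
    LinearMap.smul_apply, map_one, mul_one, smul_eq_C_mul] at h1
  simp only [map_mul]
  linear_combination h1

theorem MonomialImage.μ_eq_one (h : MonomialImage φ k r)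
    (hφ : (Alg.ringInvolution D μ hμ).IsMap (Weyl.ringInvolution K E) φ) {i j : V} (hij : i ≠ j) :
    μ i j = 1 :=
  eq_one_of_mul_shift_eq (h.coeff_ne_zero i) (h.coeff_ne_zero' j) (h.polynomial_relation hφ hij)

/-! ### Sign constraints on the exponents and the identity between the coefficients. -/

variable [CharZero K]

theorem exists_monomialImage
    (hφ : (Alg.ringInvolution D μ hμ).IsMap (Weyl.ringInvolution K E) φ) :
    ∃ k r, MonomialImage φ k r := by
  choose k r hσ hX using fun i =>
    Weyl.exists_eq_base_mul_z (map_X_ne_zero hφ i) (D.σ i) (map_X_mul_base hφ i)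
  refine ⟨k, r, hσ, fun i h => map_X_ne_zero hφ i ?_, hX, fun i => ?_⟩
  · rw [hX, h, map_zero, zero_mul]
  · rw [map_Y_of_isMap hφ, hX, Weyl.inv_mul, Weyl.inv_z, Weyl.inv_base]

theorem MonomialImage.mul_nonpos (h : MonomialImage φ k r)
    (hφ : (Alg.ringInvolution D μ hμ).IsMap (Weyl.ringInvolution K E) φ) (i j : V) (hij : i ≠ j)
    (e : E) : k i e * k j e ≤ 0 := by
  by_contra! hpos
  refine mul_shift_ne_of_dvd (h.coeff_ne_zero i) (h.coeff_ne_zero' j) hpos ?_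
    (h.polynomial_relation hφ hij)
  -- With both entries positive, `z^{-k_j}` contains a `y_e` and `u_e` divides `q`; with both
  -- negative, `z^{k_i}` does and `u_e` divides `p`.
  rcases pos_and_pos_or_neg_and_neg_of_mul_pos hpos with ⟨-, h2⟩ | ⟨h1, -⟩
  · have hneg : (-k j) e < 0 := by rw [Finsupp.neg_apply]; omega
    exact ((Weyl.X_dvd_zCoeff hneg).mul_right _).mul_left _
  · exact ((Weyl.X_dvd_zCoeff h1).mul_left _).mul_right _

/-- By the sign condition `z^{k_i}` and `z^{-k_j}` commute, so their contributions `h` cancel from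
the polynomial relation. What remains is the mixed relation for `r_i X_i` and `Y_j r_j` in `A(Γ)`.
-/
theorem MonomialImage.mul_shift_eq (h : MonomialImage φ k r)
    (hφ : (Alg.ringInvolution D μ hμ).IsMap (Weyl.ringInvolution K E) φ) {i j : V} (hij : i ≠ j) :
    r i * shift K (k i) (shift K (-k j) (r j)) = shift K (-k j) (r j * r i) := by
  have h1 := h.polynomial_relation hφ hij
  have hc : Commute (Weyl.z K (k i)) (Weyl.z K (-k j)) := Weyl.z_commute fun e => by
    rw [Finsupp.neg_apply, mul_neg, neg_nonneg]
    exact h.mul_nonpos hφ i j hij e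
  have h2 := congrArg (fun w => Weyl.act K E w 1) hc.eq
  simp only [map_mul, Module.End.mul_apply, Weyl.act_z, map_one, mul_one] at h2
  rw [h.μ_eq_one hφ hij, map_one, one_mul] at h1
  simp only [map_mul] at h1 ⊢
  have hne : Weyl.zCoeff K (k i) * shift K (k i) (Weyl.zCoeff K (-k j)) ≠ 0 :=
    mul_ne_zero (Weyl.zCoeff_ne_zero _)
      ((map_ne_zero_iff _ (shift K (k i)).injective).2 (Weyl.zCoeff_ne_zero _))
  refine mul_left_cancel₀ hne ?_
  linear_combination h1 - (shift K (-k j) (r j) * shift K (-k j) (r i)) * h2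

/-! ### The factorization -/

variable {Γ : Multiquiver V E}

/-- The images of the generators in `A(Γ)`. -/
def factorGen (Γ : Multiquiver V E) (r : V → MvPolynomial E K) :
    Gen (MvPolynomial E K) V → Γ.algebra K
  | .base s => Alg.base _ _ s
  | .X i => Alg.base _ _ (r i) * Alg.X _ _ i
  | .Y i => Alg.Y _ _ i * Alg.base _ _ (r i)

theorem factorGen_rel (h : MonomialImage φ k r)
    (hφ : (Alg.ringInvolution D μ hμ).IsMap (Weyl.ringInvolution K E) φ)
    (hΓ : ∀ i, Γ.γ i = k i) ⦃a b : FreeAlgebra K (Gen (MvPolynomial E K) V)⦄ (hab : Rel D μ a b) :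
    FreeAlgebra.lift K (factorGen Γ r) a = FreeAlgebra.lift K (factorGen Γ r) b := by
  have hσ (i : V) : (Γ.datum K).σ i = shift K (k i) := by rw [← hΓ]; rfl
  have ht (i : V) : D.t i = shift K (-k i) (r i * r i) * (Γ.datum K).t i := by
    rw [h.t_eq hφ, ← hΓ]; rfl
  induction hab <;> simp only [map_add, map_mul, map_smul, FreeAlgebra.lift_ι_apply, factorGen,
    AlgHom.commutes]
  case X_base i s =>
    rw [mul_assoc, Alg.X_mul_base, ← mul_assoc, ← mul_assoc, ← map_mul, ← map_mul, hσ, h.σ_eq,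
      mul_comm]
  case Y_base i s =>
    rw [mul_assoc, ← map_mul, mul_comm, map_mul, ← mul_assoc, Alg.Y_mul_base, hσ, h.σ_eq,
      mul_assoc]
  case YX i =>
    rw [mul_assoc, ← mul_assoc (Alg.base _ _ _), ← map_mul, ← mul_assoc, Alg.Y_mul_base,
      mul_assoc, Alg.Y_mul_X, ← map_mul, ht, hσ, shift_symm, Finsupp.coe_neg]
  case XY i =>
    rw [mul_assoc, ← mul_assoc (Alg.X _ _ _), Alg.X_mul_Y, ← map_mul, ← map_mul, ht, h.σ_eq, hσ,
      map_mul (shift K (k i)), Finsupp.coe_neg, shift_shift_neg]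
    congr 1
    ring
  case XY_ne i j hij =>
    rw [h.μ_eq_one hφ hij, one_smul, Alg.Y_mul_base, mul_assoc, ← mul_assoc (Alg.X _ _ _),
      Alg.X_mul_base, mul_assoc, Alg.X_mul_Y_ne hij, one_smul, ← mul_assoc, ← map_mul,
      mul_assoc (Alg.base _ _ _), ← mul_assoc (Alg.Y _ _ _) (Alg.base _ _ _), Alg.Y_mul_base]
    simp only [← mul_assoc, ← map_mul]
    rw [hσ, hσ, shift_symm, shift_symm, ← Finsupp.coe_neg, h.mul_shift_eq hφ hij]

/-- The map to `A(Γ)`, before passing to the quotient. -/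
def constrFactor (h : MonomialImage φ k r)
    (hφ : (Alg.ringInvolution D μ hμ).IsMap (Weyl.ringInvolution K E) φ)
    (hΓ : ∀ i, Γ.γ i = k i) : Constr D μ →ₐ[K] Γ.algebra K :=
  Constr.lift (factorGen Γ r) (factorGen_rel h hφ hΓ)

theorem constrFactor_gen (h : MonomialImage φ k r)
    (hφ : (Alg.ringInvolution D μ hμ).IsMap (Weyl.ringInvolution K E) φ)
    (hΓ : ∀ i, Γ.γ i = k i) (g : Gen (MvPolynomial E K) V) :
    constrFactor h hφ hΓ (Constr.gen D μ g) = factorGen Γ r g := Constr.lift_gen _ _ _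

theorem rep_constrFactor (h : MonomialImage φ k r)
    (hφ : (Alg.ringInvolution D μ hμ).IsMap (Weyl.ringInvolution K E) φ)
    (hΓ : ∀ i, Γ.γ i = k i) (a : Constr D μ) :
    rep K Γ (constrFactor h hφ hΓ a) = φ (Alg.mk D μ a) := by
  -- `φ` is promoted to a `K`-algebra map so that the comparison can be made on generators.
  let φ' : Alg D μ →ₐ[K] Weyl K E := AlgHom.mk φ fun c => by
    have := map_smul_of_isMap hφ c 1
    rw [map_one, ← Algebra.algebraMap_eq_smul_one, ← Algebra.algebraMap_eq_smul_one] at this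
    exact this
  have hcomp : (rep K Γ).comp (constrFactor h hφ hΓ) = φ'.comp (Alg.mk D μ) := by
    refine Constr.algHom_ext fun g => ?_
    rw [AlgHom.comp_apply, constrFactor_gen]
    cases g with
    | base s => exact (rep_base Γ s).trans (map_base_of_isMap hφ s).symm
    | X i =>
      refine (map_mul _ _ _).trans (Eq.trans ?_ (h.map_X i).symm)
      rw [rep_base, rep_X, hΓ]
    | Y i =>
      refine (map_mul _ _ _).trans (Eq.trans ?_ (h.map_Y i).symm)
      rw [rep_base, rep_Y, hΓ]
  exact DFunLike.congr_fun hcomp a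

theorem constrFactor_mem_comp (h : MonomialImage φ k r)
    (hφ : (Alg.ringInvolution D μ hμ).IsMap (Weyl.ringInvolution K E) φ)
    (hΓ : ∀ i, Γ.γ i = k i) {d : V →₀ ℤ} {a : Constr D μ} (ha : a ∈ Constr.comp D μ d) :
    constrFactor h hφ hΓ a ∈ Alg.comp (Γ.datum K) (fun _ _ => 1) d := by
  refine map_mem_comp (fun g => ?_) ha
  rw [constrFactor_gen]
  cases g with
  | base s => exact Alg.base_mem_comp_zero s
  | X i =>
    have := Alg.mul_mem_comp (Alg.base_mem_comp_zero (D := Γ.datum K) (μ := fun _ _ => 1) (r i))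
      (Alg.mk_gen_mem_comp (.X i))
    rwa [zero_add] at this
  | Y i =>
    have := Alg.mul_mem_comp (Alg.mk_gen_mem_comp (.Y i))
      (Alg.base_mem_comp_zero (D := Γ.datum K) (μ := fun _ _ => 1) (r i))
    rwa [add_zero] at this

/-- A homogeneous element of a null ideal has homogeneous image in `A(Γ)`. Under `rep` this image
goes to `φ` of its zero class, and `rep` is injective on homogeneous elements. -/
theorem constrFactor_eq_zero (h : MonomialImage φ k r)
    (hφ : (Alg.ringInvolution D μ hμ).IsMap (Weyl.ringInvolution K E) φ)
    (hΓ : ∀ i, Γ.γ i = k i) {a : Constr D μ} (ha : a ∈ radical D μ) :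
    constrFactor h hφ hΓ a = 0 := by
  have hle : radical D μ ≤ RingHom.ker (constrFactor h hφ hΓ).toRingHom :=
    sSup_le fun J hJ x hx => by
      refine (AddSubgroup.closure_le
        (K := (RingHom.ker (constrFactor h hφ hΓ).toRingHom).toAddSubgroup)).2 ?_
        (hJ.graded x hx)
      rintro b ⟨hb, d, hd⟩
      refine eq_zero_of_rep_eq_zero (constrFactor_mem_comp h hφ hΓ hd) ?_
      refine (rep_constrFactor h hφ hΓ b).trans ?_
      have hb' : b ∈ radical D μ := Submodule.mem_sSup_of_mem hJ hb
      rw [Alg.mk_eq_zero.2 hb', map_zero]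
  exact hle ha

theorem factors_of_γ_eq (h : MonomialImage φ k r)
    (hφ : (Alg.ringInvolution D μ hμ).IsMap (Weyl.ringInvolution K E) φ)
    (hΓ : ∀ i, Γ.γ i = k i) : Γ.Factors hμ φ := by
  set ξ : Alg D μ →ₐ[K] Γ.algebra K :=
    Alg.lift (constrFactor h hφ hΓ) fun a ha => constrFactor_eq_zero h hφ hΓ ha
  have hξ (a : Constr D μ) : ξ (Alg.mk D μ a) = constrFactor h hφ hΓ a := rfl
  have hbase (s : MvPolynomial E K) : ξ (Alg.base D μ s) = Alg.base _ _ s :=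
    constrFactor_gen h hφ hΓ (.base s)
  refine ⟨_, isCanonicalRep_rep Γ, (ξ : Alg D μ →+* Γ.algebra K), ⟨?_, ?_⟩, ?_, ?_⟩
  · exact RingHom.ext hbase
  · refine map_inv_of_gen hμ ξ (Γ.ringInvolution K) (fun c => ?_) fun g => ?_
    · rw [← (Alg.base (Γ.datum K) (fun _ _ => 1)).commutes]
      exact (Γ.ringInvolution K).inv_ρ _
    · rw [hξ, hξ, constrFactor_gen, constrFactor_gen]
      have hinv (s : MvPolynomial E K) : (Γ.ringInvolution K).inv (Alg.base _ _ s) =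
          Alg.base _ _ s := (Γ.ringInvolution K).inv_ρ s
      cases g with
      | base s => exact (hinv s).symm
      | X i =>
        refine Eq.symm (((Γ.ringInvolution K).inv_mul _ _).trans ?_)
        rw [hinv]
        exact congrArg (· * _) (Alg.inv_X _ _ _ i)
      | Y i =>
        refine Eq.symm (((Γ.ringInvolution K).inv_mul _ _).trans ?_)
        rw [hinv]
        exact congrArg (_ * ·) (Alg.inv_Y _ _ _ i)
  · rintro d _ ⟨a, ha, rfl⟩
    exact constrFactor_mem_comp h hφ hΓ ha
  · refine RingHom.ext fun a => ?_
    obtain ⟨a, rfl⟩ := Alg.mk_surjective D μ a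
    exact rep_constrFactor h hφ hΓ a

/-- `ξ(X_i)` has degree `i`, so it moves past `R_E` by `τ_{γ(i)}`, while `φ(X_i)` does so by `σ_i`.
Comparing the two in the Weyl algebra and cancelling the nonzero `φ(X_i)` gives equality, which ties
the columns of `Γ` to the datum alone. -/
theorem σ_eq_shift_of_factors
    (hφ : (Alg.ringInvolution D μ hμ).IsMap (Weyl.ringInvolution K E) φ) (hΓ : Γ.Factors hμ φ)
    (i : V) (s : MvPolynomial E K) : D.σ i s = shift K (Γ.γ i) s := by
  obtain ⟨φΓ, hrep, ξ, -, hgr, hcomp⟩ := hΓ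
  have hX : φΓ (ξ (Alg.X D μ i)) = φ (Alg.X D μ i) := RingHom.congr_fun hcomp _
  have hb (s : MvPolynomial E K) : φΓ (Alg.base _ _ s) = Weyl.base K E s :=
    RingHom.congr_fun hrep.isMap.1 s
  have h1 := congrArg φΓ (Alg.mul_base_of_mem_comp
    (hgr (Finsupp.single i 1) _ (Alg.mk_gen_mem_comp (.X i))) s)
  rw [map_mul, map_mul, hb, hb, weight_single, one_smul] at h1
  change φΓ (ξ (Alg.X D μ i)) * _ = _ * φΓ (ξ (Alg.X D μ i)) at h1
  rw [hX, map_X_mul_base hφ] at h1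
  by_contra hne
  refine map_X_ne_zero hφ i (Weyl.eq_zero_of_base_mul_eq_zero (sub_ne_zero.2 hne) ?_)
  rw [map_sub, sub_mul, h1, sub_self]

end Hom

end

end TGW

theorem theorem4p11 {K V E : Type*} [Field K] [CharZero K]
    (D : TGW.Datum K (MvPolynomial E K) V) (μ : V → V → K)
    (hμ0 : ∀ i j, i ≠ j → μ i j ≠ 0) (hμ : ∀ i j, i ≠ j → μ i j = μ j i)
    (φ : TGW.Alg D μ →+* TGW.Weyl K E)
    (hφ : (TGW.Alg.ringInvolution D μ hμ).IsMap (TGW.Weyl.ringInvolution K E) φ) :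
    TGW.IsConsistent D μ ∧
    (∃ Γ : Multiquiver V E, Γ.Factors hμ φ) ∧
    ((∀ i, φ (TGW.Alg.X D μ i) ≠ 0) →
      (∃! Γ : Multiquiver V E, Γ.Factors hμ φ) ∧ ∀ i j, i ≠ j → μ i j = 1) := by
  obtain ⟨k, r, h⟩ := TGW.exists_monomialImage hφ
  have hΓ : (Multiquiver.ofColumns k (h.mul_nonpos hφ)).Factors hμ φ :=
    TGW.factors_of_γ_eq h hφ (Multiquiver.γ_ofColumns k _)
  refine ⟨TGW.isConsistent_of_isMap hφ, ⟨_, hΓ⟩, fun _ =>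
    ⟨⟨_, hΓ, fun Γ' hΓ' => Multiquiver.ext_of_γ fun v => ?_⟩, fun i j hij => h.μ_eq_one hφ hij⟩⟩
  -- Both columns induce the same automorphism `σ_v`, and in characteristic zero a shift determines
  -- its integer vector.
  refine DFunLike.coe_injective (TGW.shift_injective (K := K) fun s => ?_)
  rw [← TGW.σ_eq_shift_of_factors hφ hΓ' v s, ← TGW.σ_eq_shift_of_factors hφ hΓ v s]
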